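/- Consider $\alpha_1,\alpha_2,\alpha_3>0$ with $\frac1{\alpha_1}=\frac1{\alpha_2}+\frac1{\alpha_3}$, put $Q(u)=(\alpha_1+u)(\alpha_2-u)(\alpha_3-u)$, and let $u,\theta_1,\theta_2,\theta_3:\mathbb R\to\mathbb R$ be differentiable functions with $\alpha_1+u>0$, $\alpha_2-u>0$, $\alpha_3-u>0$ everywhere which, with $\theta=\theta_1+\theta_2+\theta_3$, satisfy $$\frac{du}{dt}=2Q(u)^{1/2}\cos\theta,\qquad \frac{d\theta_1}{dt}=-\frac{Q(u)^{1/2}\sin\theta}{\alpha_1+u},\qquad \frac{d\theta_j}{dt}=\frac{Q(u)^{1/2}\sin\theta}{\alpha_j-u}\quad(j=2,3),$$ and $0<A<(\alpha_1\alpha_2\alpha_3)^{1/2}$, where $A=Q(u(0))^{1/2}\sin\theta(0)$. Suppose that $T>0$ is the least common period of $u$ and $\theta$, and that $\theta_j(t+T)=\theta_j(t)+\beta_j$ for all $t$, where $\beta_j=\pi a_j/b$ with integers $a_1,a_2,a_3,b$, $b>0$, $\operatorname{hcf}(a_1,a_2,a_3,b)=1$ and $a_1$ even. For $c\in\mathbb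 R$ define $$N=N_c=\bigl\{\bigl(x_1e^{i\theta_1(t)}\sqrt{\alpha_1+u(t)},\ x_2e^{i\theta_2(t)}\sqrt{\alpha_2-u(t)},\ x_3e^{i\theta_3(t)}\sqrt{\alpha_3-u(t)}\bigr): t,x_j\in\mathbb R,\ x_1^2-x_2^2-x_3^2=c\bigr\}\subset\mathbb C^3,$$ and let $N_+$ and $N_-$ be the subsets of $N$ given by $x_1\ge 0$ and by $x_1\le 0$ respectively. Here a subset of $\mathbb C^3$ is called a closed, nonsingular, immersed special Lagrangian submanifold diffeomorphic to a 3-manifold $M$ if it is closed and is the image of a proper smooth immersion $\Phi:M\to\mathbb C^3$ that is generically injective (each point of some dense open set is the only point of its fibre) and whose tangent planes $V$, suitably oriented, satisfy $\operatorname{Re}(dz_1\wedge dz_2\wedge dz_3)|_V=\operatorname{vol}_V$. It is called a closed, immersed special Lagrangian cone on $T^2$ with an isolated singular point at $0$ if it is closed and equals $\{r\Psi(p):r\ge0,\ p\in T^2\}$ for some generically injective map $\Psi$ from $T^2$ to the unit sphere such that $(p,r)\mapsto r\Psi(p)$ is a smooth special Lagrangian immersion of $T^2\times(0,\infty)$,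 and no smooth immersed 3-dimensional disc through $0$ is contained in it. These sets form a countably infinite collection of 1-parameter families of distinct special Lagrangian 3-folds, parametrized by $c\in\mathbb R$, in the following sense. The set of triples $(\beta_1,\beta_2,\beta_3)$ that arise is countably infinite. Sets $N_c$ and $N'_{c'}$ that arise from data with different triples are always distinct. For fixed data the sets $N_c$, $c\in\mathbb R$, are pairwise distinct. Moreover, for all such data: (a) If $c>0$, then $N=N_+\cup N_-$, where $N_+\ne N_-$ and $N_-=-N_+$, and each of $N_\pm$ is a closed, nonsingular, immersed special Lagrangian submanifold diffeomorphic to $\mathcal S^1\times\mathbb R^2$. (b) If $c<0$, then $N$ is a closed, nonsingular, immersed special Lagrangian submanifold diffeomorphic to $T^2\times\mathbb R$, and $N=-N$. (c) If $c=0$, then $N=N_+\cup N_-$, where $N_+\ne N_-$ and $N_-=-N_+$, and each of $N_\pm$ is a closed, immersed special Lagrangian cone on $T^2$ with an isolated singular point at $0$. -/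

import Mathlib

open scoped Manifold ContDiff Topology Pointwise

noncomputable section

namespace SLQuadric

/-! ### Special Lagrangian immersions into complex 3-space -/

/-- The space `ℂ³`. Its real inner product is `g = |dz₁|² + |dz₂|² + |dz₃|²`. -/
abbrev C3 : Type := EuclideanSpace ℂ (Fin 3)

/-- The complex volume form `Ω = dz₁ ∧ dz₂ ∧ dz₃`. -/
def Omega (v : Fin 3 → C3) : ℂ := (Matrix.of fun i j => v j i).det

/-- A real 3-plane `V` in `ℂ³` is a special Lagrangian plane if it has an orientation for which
`Re Ω` restricts to the volume form of `V`. This orientation is the one on which `Re Ω` is positive,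
so on a family of special Lagrangian planes it is unique and varies continuously. -/
def IsSpecialLagrangianPlane (V : Submodule ℝ C3) : Prop :=
  ∃ (_ : Fact (Module.finrank ℝ V = 3)) (o : Orientation ℝ V (Fin 3)),
    ∀ v : Fin 3 → V, (Omega fun i => (v i : C3)).re = o.volumeForm v

section Immersions

variable {E : Type*} [NormedAddCommGroup E] [NormedSpace ℝ E]
  {H : Type*} [TopologicalSpace H] (I : ModelWithCorners ℝ E H)
  {M : Type*} [TopologicalSpace M] [ChartedSpace H M]

/-- `Φ` is smooth near `p`, its differential at `p` is injective, and the image of the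
differential is a special Lagrangian plane. -/
structure IsSLImmersionAt (Φ : M → C3) (p : M) : Prop where
  smooth : ContMDiffAt I 𝓘(ℝ, C3) ∞ Φ p
  injective : Function.Injective (mfderiv I 𝓘(ℝ, C3) Φ p)
  plane : IsSpecialLagrangianPlane
    (LinearMap.range (mfderiv I 𝓘(ℝ, C3) Φ p : E →L[ℝ] C3).toLinearMap)

/-- Every point of some dense open set is the only point of its fibre. -/
def IsGenericallyInjective {X Y : Type*} [TopologicalSpace X] (Φ : X → Y) : Prop :=
  ∃ W : Set X, IsOpen W ∧ Dense W ∧ ∀ p ∈ W, ∀ q, Φ q = Φ p → q = p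

variable (M) in
/-- `S ⊆ ℂ³` is a closed, nonsingular, immersed special Lagrangian submanifold which, as an immersed
submanifold, is diffeomorphic to `M`: it is the image of a proper, generically injective, special
Lagrangian immersion of `M`. Generic injectivity prevents `M` from being a proper covering of the
immersed submanifold meant. -/
def IsClosedImmersedSL (S : Set C3) : Prop :=
  IsClosed S ∧ ∃ Φ : M → C3, (∀ p, IsSLImmersionAt I Φ p) ∧ IsProperMap Φ ∧
    IsGenericallyInjective Φ ∧ Set.range Φ = S

end Immersions

/-- Some smooth immersed 3-dimensional disc through `p` lies in `S`. The points of an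
immersed 3-dimensional submanifold at which this fails are its singular points. -/
def IsImmersedPoint (S : Set C3) (p : C3) : Prop :=
  ∃ f : EuclideanSpace ℝ (Fin 3) → C3, ContDiffAt ℝ ∞ f 0 ∧
    Function.Injective (fderiv ℝ f 0) ∧ f 0 = p ∧ ∀ᶠ x in 𝓝 0, f x ∈ S

/-- `S ⊆ ℂ³` is a closed, immersed special Lagrangian cone on `T²`, with an isolated singular point
at `0`: it is the cone on the image of a generically injective map `Ψ` from `T²` to the unit
sphere, the map `(p, r) ↦ r Ψ(p)` is a special Lagrangian immersion of `T² × (0, ∞)`, and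
`0` is a singular point. -/
def IsClosedImmersedSLConeOnTorus (S : Set C3) : Prop :=
  IsClosed S ∧ (∃ Ψ : Circle × Circle → C3, (∀ p, ‖Ψ p‖ = 1) ∧ IsGenericallyInjective Ψ ∧
    (∀ p, ∀ r : ℝ, 0 < r → IsSLImmersionAt (((𝓡 1).prod (𝓡 1)).prod 𝓘(ℝ, ℝ))
      (fun q : (Circle × Circle) × ℝ => q.2 • Ψ q.1) (p, r)) ∧
    S = {z | ∃ r : ℝ, 0 ≤ r ∧ ∃ p, z = r • Ψ p}) ∧
  ¬ IsImmersedPoint S 0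

/-! ### Evolving quadrics -/

/-- The signs of the quadratic form `x₁² - x₂² - x₃²`. -/
def sgn : Fin 3 → ℝ := ![1, -1, -1]

/-- `Q(u) = (α₁ + u) (α₂ - u) (α₃ - u)`. -/
def Q (α : Fin 3 → ℝ) (u : ℝ) : ℝ := ∏ j, (α j + sgn j * u)

/-- A solution, for all time, of the evolution equations
`u' = 2 Q(u)^{1/2} cos θ`, `θ₁' = -Q(u)^{1/2} sin θ / (α₁ + u)`,
`θⱼ' = Q(u)^{1/2} sin θ / (αⱼ - u)` for `j = 2, 3`, where `θ = θ₁ + θ₂ + θ₃`, with `αⱼ > 0`,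
`1/α₁ = 1/α₂ + 1/α₃` and `0 < A < (α₁ α₂ α₃)^{1/2}`, where `A = Q(u(0))^{1/2} sin θ(0)`. -/
structure Solution where
  α : Fin 3 → ℝ
  u : ℝ → ℝ
  θ : Fin 3 → ℝ → ℝ
  α_pos : ∀ j, 0 < α j
  α_normalized : ∑ j, sgn j / α j = 0
  radius_pos : ∀ j t, 0 < α j + sgn j * u t
  deriv_u : ∀ t, HasDerivAt u (2 * √(Q α (u t)) * Real.cos (∑ i, θ i t)) t
  deriv_θ : ∀ j t, HasDerivAt (θ j)
    (-(sgn j * (√(Q α (u t)) * Real.sin (∑ i, θ i t)) / (α j + sgn j * u t))) t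
  A_pos : 0 < √(Q α (u 0)) * Real.sin (∑ i, θ i 0)
  A_lt : √(Q α (u 0)) * Real.sin (∑ i, θ i 0) < √(∏ j, α j)

namespace Solution

variable (D : Solution)

/-- The point `(x₁ e^{iθ₁(t)} √(α₁ + u(t)), x₂ e^{iθ₂(t)} √(α₂ - u(t)),
x₃ e^{iθ₃(t)} √(α₃ - u(t)))`. -/
def point (t : ℝ) (x : Fin 3 → ℝ) : C3 :=
  WithLp.toLp 2 fun j =>
    (x j : ℂ) * Complex.exp (Complex.I * (D.θ j t : ℂ)) * ((√(D.α j + sgn j * D.u t) : ℝ) : ℂ)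

/-- The set `N` swept out by the evolving quadric `x₁² - x₂² - x₃² = c`. -/
def N (c : ℝ) : Set C3 := {z | ∃ t x, ∑ j, sgn j * x j ^ 2 = c ∧ z = D.point t x}

/-- The piece `N₊` of `N` swept out by the part `x₁ ≥ 0` of the quadric. -/
def Npos (c : ℝ) : Set C3 :=
  {z | ∃ t x, ∑ j, sgn j * x j ^ 2 = c ∧ 0 ≤ x 0 ∧ z = D.point t x}

/-- The piece `N₋` of `N` swept out by the part `x₁ ≤ 0` of the quadric. -/
def Nneg (c : ℝ) : Set C3 :=
  {z | ∃ t x, ∑ j, sgn j * x j ^ 2 = c ∧ x 0 ≤ 0 ∧ z = D.point t x}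

end Solution

/-- A solution for which `u` and `θ` have (least) period `T > 0` and
`θⱼ(t + T) = θⱼ(t) + π aⱼ / b`, with integers `a₁, a₂, a₃, b` such that `b > 0` and
`hcf(a₁, a₂, a₃, b) = 1`, and with `a₁` even. -/
structure EvenPeriodicSolution extends Solution where
  T : ℝ
  a : Fin 3 → ℤ
  b : ℕ
  period : IsLeast {S : ℝ | 0 < S ∧ Function.Periodic u S ∧
    Function.Periodic (fun t => ∑ i, θ i t) S} T
  shift : ∀ j t, θ j (t + T) = θ j t + Real.pi * a j / b
  b_pos : 0 < b
  coprime : Nat.Coprime b (Finset.univ.gcd fun j => (a j).natAbs)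
  even : Even (a 0)

/-- The rotation angles `βⱼ = π aⱼ / b`, which label the families. -/
def EvenPeriodicSolution.β (F : EvenPeriodicSolution) (j : Fin 3) : ℝ := Real.pi * F.a j / F.b

end SLQuadric

end

/-!
Write `ρⱼ = αⱼ ± u` for the squared moduli and `wⱼ = e^{iθⱼ} ρⱼ^{1/2}` for the coefficients of the
evolving quadric, so that the points of `N` are `(x₁w₁, x₂w₂, x₃w₃)`. Then `A = Q(u)^{1/2} sin θ` is
conserved, and with `B = Q(u)^{1/2} cos θ` one has the Hamiltonian system `u' = 2B`, `B' = Q'(u)`,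
and `w₁w₂w₃ = B + iA`, `wⱼ' = ± wⱼ (B - iA) / ρⱼ`. The solution is thus determined by `u` and `B` at
one time, up to constants added to the `θⱼ` (`Solution.shift_of_eq`).

*The immersions.* From the formula for `wⱼ'` the Kähler form and `Im Ω` vanish on the span of
`∂/∂t` and the directions tangent to the quadric (`Solution.isSpecialLagrangianPlane_range`), and an
orthonormal basis of a 3-plane with this property is unitary with `Ω = ±1`. As `A ≠ 0`, the map
`(t, x) ↦ (x₁w₁, x₂w₂, x₃w₃)` is an immersion off `x = 0`. After the time `bT` the coefficient `wⱼ`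
is multiplied by `(-1)^{aⱼ}`. Here `a₁` is even, and `a₁ + a₂ + a₃ = 0` since `θ` is periodic, so
that the `(x₂, x₃)`-plane is multiplied by a single sign, which a rotating frame undoes. This
descends the immersion to the circle of times (`EvenPeriodicSolution.sweep`) times the quadric or
its half: a plane for `c > 0`, a cylinder for `c < 0`, and a cone on a circle for `c = 0`.

*Generic injectivity.* A point of `ℂ³` with nonzero coordinates determines `u`, because for given
`|zⱼ|` the quadratic form is monotone in `u`. It also determines the `θⱼ` modulo `π`, so that `θ`,
whose sine is positive, is determined exactly. Hence it determines the time modulo `T`, and, as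
`hcf(a₁, a₂, a₃, b) = 1`, modulo `bT` (`EvenPeriodicSolution.exists_int_of_point_eq`). The same
argument gives `N₊ ≠ N₋`.

*Distinctness.* The extent of `N` along the axes determines `c`. In the planes `z₃ = 0` and `z₂ = 0`
the set `N` is asymptotic to the cones `|z₁|² = k |zⱼ|²` with `k` in the range of `ρ₁/ρⱼ`, whose
maximum is attained where `u` is maximal. So `N` determines the `ρⱼ` at a maximum of `u` up to a
common factor, and the normalization `1/α₁ = 1/α₂ + 1/α₃` fixes the `αⱼ` and `u` there, up to this
factor. As `B = 0` at the maximum, the solution is determined up to scaling, time shift and constant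
rotations, and these do not affect the angles `βⱼ` (`EvenPeriodicSolution.β_eq_of_N_eq`).

*Infinitely many triples.* There are countably many triples since each is given by integers. For
`α = (1, 2, 2)` there is a solution on which `u` has minimum `-m`, for every `0 < m < 1`
(`exists_solution`). It has `β₁ = -2β₂ = -2β₃`, so `a₁` is even as soon as `β₂` is a rational
multiple of `π`. The angle `-β₁` depends continuously on `m`. It tends to `2π/√3` as `m → 0`, and is
smaller at `m = 6/7`, where the integral defining it can be estimated (`angle_le`). Hence `β₂` takes
all values in an interval.
-/

open scoped Manifold ContDiff Topology Pointwise

noncomputable section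

namespace SLQuadric

/-! ### The evolution equations -/

/-- The derivative of `Q`. -/
def Q' (α : Fin 3 → ℝ) (u : ℝ) : ℝ :=
  (α 1 - u) * (α 2 - u) - (α 0 + u) * (α 2 - u) - (α 0 + u) * (α 1 - u)

@[simp] lemma sgn_zero : sgn 0 = 1 := rfl
@[simp] lemma sgn_one : sgn 1 = -1 := rfl
@[simp] lemma sgn_two : sgn 2 = -1 := rfl

lemma Q_eq (α : Fin 3 → ℝ) (u : ℝ) : Q α u = (α 0 + u) * (α 1 - u) * (α 2 - u) := by
  simp [Q, Fin.prod_univ_three, sub_eq_add_neg]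

lemma hasDerivAt_Q (α : Fin 3 → ℝ) (u : ℝ) : HasDerivAt (Q α) (Q' α u) u := by
  have h : Q α = fun u => (α 0 + u) * (α 1 - u) * (α 2 - u) := funext (Q_eq α)
  rw [h]
  have h0 : HasDerivAt (fun u => α 0 + u) 1 u := (hasDerivAt_id u).const_add _
  have h1 : HasDerivAt (fun u => α 1 - u) (-1) u := (hasDerivAt_id u).const_sub _
  have h2 : HasDerivAt (fun u => α 2 - u) (-1) u := (hasDerivAt_id u).const_sub _
  refine ((h0.mul h1).mul h2).congr_deriv ?_
  simp only [Q', Pi.mul_apply]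
  ring

lemma contDiff_Q' (α : Fin 3 → ℝ) : ContDiff ℝ ∞ (Q' α) := by
  unfold Q'; fun_prop

/-- Bounded solutions of the Hamiltonian system `u' = 2B`, `B' = Q'(u)` are determined by their
initial values. -/
lemma eq_of_hamiltonian {α : Fin 3 → ℝ} {u₁ B₁ u₂ B₂ : ℝ → ℝ} {R : ℝ}
    (hu₁ : ∀ t, HasDerivAt u₁ (2 * B₁ t) t) (hB₁ : ∀ t, HasDerivAt B₁ (Q' α (u₁ t)) t)
    (hu₂ : ∀ t, HasDerivAt u₂ (2 * B₂ t) t) (hB₂ : ∀ t, HasDerivAt B₂ (Q' α (u₂ t)) t)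
    (bu₁ : ∀ t, |u₁ t| ≤ R) (bB₁ : ∀ t, |B₁ t| ≤ R) (bu₂ : ∀ t, |u₂ t| ≤ R)
    (bB₂ : ∀ t, |B₂ t| ≤ R) (h : u₁ 0 = u₂ 0) (h' : B₁ 0 = B₂ 0) (t : ℝ) :
    u₁ t = u₂ t ∧ B₁ t = B₂ t := by
  let v : ℝ × ℝ → ℝ × ℝ := fun x => (2 * x.2, Q' α x.1)
  have hv : ContDiff ℝ ∞ v := by
    have := contDiff_Q' α
    fun_prop
  obtain ⟨K, hK⟩ := hv.contDiffOn.exists_lipschitzOnWith (s := Metric.closedBall 0 R) (by simp)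
    (convex_closedBall _ _) (isCompact_closedBall _ _)
  have key := ODE_solution_unique_univ (v := fun _ => v) (s := fun _ => Metric.closedBall 0 R)
    (t₀ := 0) (f := fun t => (u₁ t, B₁ t)) (g := fun t => (u₂ t, B₂ t)) (fun _ => hK)
    (fun t => ⟨(hu₁ t).prodMk (hB₁ t), by simpa [Prod.norm_def] using ⟨bu₁ t, bB₁ t⟩⟩)
    (fun t => ⟨(hu₂ t).prodMk (hB₂ t), by simpa [Prod.norm_def] using ⟨bu₂ t, bB₂ t⟩⟩)
    (by simp [h, h'])
  exact Prod.mk.inj (congrFun key t)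

/-- If `sin f` never vanishes then `f` stays between two consecutive multiples of `π`. -/
lemma eq_of_sub_eq_int_mul_pi {f : ℝ → ℝ} (hf : Continuous f) (hs : ∀ t, 0 < Real.sin (f t))
    {t t' : ℝ} {n : ℤ} (h : f t' = f t + n * Real.pi) : f t' = f t := by
  wlog hn : 0 ≤ n generalizing t t' n
  · refine (this (t := t') (t' := t) (n := -n) (by push_cast; linarith) (by omega)).symm
  rcases hn.eq_or_lt with rfl | hn
  · simpa using h
  exfalso
  have hpi := Real.pi_pos
  have hn' : (1 : ℝ) ≤ n := by exact_mod_cast hn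
  set k : ℤ := ⌈f t / Real.pi⌉
  have h1 : f t ≤ k * Real.pi := by
    have := Int.le_ceil (f t / Real.pi)
    rwa [div_le_iff₀ hpi] at this
  have h2 : k * Real.pi ≤ f t' := by
    have := (Int.ceil_lt_add_one (f t / Real.pi)).le
    rw [div_add_one hpi.ne', le_div_iff₀ hpi] at this
    nlinarith
  obtain ⟨s, hs'⟩ := mem_range_of_exists_le_of_exists_ge hf ⟨t, h1⟩ ⟨t', h2⟩
  have := hs s
  rw [hs', Real.sin_int_mul_pi] at this
  exact lt_irrefl _ this

namespace Solution

variable (D : Solution)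

/-- The squared moduli `ρⱼ = αⱼ ± u` of the coefficients of the evolving quadric. -/
def ρ (j : Fin 3) (t : ℝ) : ℝ := D.α j + sgn j * D.u t

/-- The sum of the three phases. -/
def Θ (t : ℝ) : ℝ := ∑ i, D.θ i t

/-- The conserved quantity `A = Q(u)^{1/2} sin θ`. -/
def A : ℝ := √(Q D.α (D.u 0)) * Real.sin (D.Θ 0)

/-- The quantity `B = Q(u)^{1/2} cos θ`, for which `u' = 2B`, `B' = Q'(u)`. -/
def B (t : ℝ) : ℝ := √(Q D.α (D.u t)) * Real.cos (D.Θ t)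

lemma ρ_pos (j : Fin 3) (t : ℝ) : 0 < D.ρ j t := D.radius_pos j t

lemma Q_eq_prod_ρ (t : ℝ) : Q D.α (D.u t) = D.ρ 0 t * D.ρ 1 t * D.ρ 2 t := by
  simp [Q, ρ, Fin.prod_univ_three]

lemma Q_pos (t : ℝ) : 0 < Q D.α (D.u t) := by
  rw [Q_eq_prod_ρ]
  exact mul_pos (mul_pos (D.ρ_pos 0 t) (D.ρ_pos 1 t)) (D.ρ_pos 2 t)

lemma Q'_eq (t : ℝ) : Q' D.α (D.u t) =
    Q D.α (D.u t) * (1 / D.ρ 0 t - 1 / D.ρ 1 t - 1 / D.ρ 2 t) := by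
  have h0 := (D.ρ_pos 0 t).ne'
  have h1 := (D.ρ_pos 1 t).ne'
  have h2 := (D.ρ_pos 2 t).ne'
  rw [Q_eq_prod_ρ]
  field_simp
  simp [Q', ρ]
  ring

lemma hasDerivAt_u (t : ℝ) : HasDerivAt D.u (2 * D.B t) t :=
  (D.deriv_u t).congr_deriv (by simp [B, Θ, mul_assoc])

lemma continuous_u : Continuous D.u :=
  continuous_iff_continuousAt.2 fun t => (D.deriv_u t).continuousAt

lemma continuous_θ (j : Fin 3) : Continuous (D.θ j) :=
  continuous_iff_continuousAt.2 fun t => (D.deriv_θ j t).continuousAt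

lemma continuous_Θ : Continuous D.Θ := continuous_finsetSum _ fun j _ => D.continuous_θ j

lemma hasDerivAt_Θ (t : ℝ) : HasDerivAt D.Θ
    (-(Real.sin (D.Θ t) * Q' D.α (D.u t) / √(Q D.α (D.u t)))) t := by
  refine (HasDerivAt.fun_sum fun j (_ : j ∈ Finset.univ) => D.deriv_θ j t).congr_deriv ?_
  have hQ := Real.mul_self_sqrt (D.Q_pos t).le
  have hs := (Real.sqrt_pos.2 (D.Q_pos t)).ne'
  rw [Q'_eq]
  simp only [Fin.sum_univ_three, sgn_zero, sgn_one, sgn_two, Θ]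
  change -(_ / D.ρ 0 t) + -(_ / (D.α 1 + -1 * D.u t)) + -(_ / (D.α 2 + -1 * D.u t)) = _
  have e1 : D.α 1 + -1 * D.u t = D.ρ 1 t := rfl
  have e2 : D.α 2 + -1 * D.u t = D.ρ 2 t := rfl
  rw [e1, e2]
  have h0 := (D.ρ_pos 0 t).ne'
  have h1 := (D.ρ_pos 1 t).ne'
  have h2 := (D.ρ_pos 2 t).ne'
  set q := √(Q D.α (D.u t))
  rw [← hQ]
  field_simp
  ring

lemma hasDerivAt_sqrt_Q (t : ℝ) : HasDerivAt (fun t => √(Q D.α (D.u t)))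
    (Q' D.α (D.u t) * Real.cos (D.Θ t)) t := by
  have h := ((hasDerivAt_Q D.α (D.u t)).comp t (D.hasDerivAt_u t)).sqrt (D.Q_pos t).ne'
  refine h.congr_deriv ?_
  have hs := (Real.sqrt_pos.2 (D.Q_pos t)).ne'
  simp only [B, Function.comp_apply]
  field_simp

lemma sqrt_Q_mul_sin (t : ℝ) : √(Q D.α (D.u t)) * Real.sin (D.Θ t) = D.A := by
  have h : ∀ t, HasDerivAt (fun t => √(Q D.α (D.u t)) * Real.sin (D.Θ t)) 0 t := fun t => by
    refine ((D.hasDerivAt_sqrt_Q t).mul (D.hasDerivAt_Θ t).sin).congr_deriv ?_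
    have hs := (Real.sqrt_pos.2 (D.Q_pos t)).ne'
    field_simp
    ring
  exact is_const_of_deriv_eq_zero (fun t => (h t).differentiableAt) (fun t => (h t).deriv) t 0

lemma A_pos' : 0 < D.A := D.A_pos

lemma hasDerivAt_B (t : ℝ) : HasDerivAt D.B (Q' D.α (D.u t)) t := by
  refine ((D.hasDerivAt_sqrt_Q t).mul (D.hasDerivAt_Θ t).cos).congr_deriv ?_
  have hs := (Real.sqrt_pos.2 (D.Q_pos t)).ne'
  have := Real.sin_sq_add_cos_sq (D.Θ t)
  field_simp
  linear_combination (Q' D.α (D.u t)) * this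

lemma sin_Θ_pos (t : ℝ) : 0 < Real.sin (D.Θ t) := by
  have h := D.A_pos'
  rw [← D.sqrt_Q_mul_sin t] at h
  exact pos_of_mul_pos_right h (Real.sqrt_nonneg _)

lemma A_sq_add_B_sq (t : ℝ) : D.A ^ 2 + D.B t ^ 2 = Q D.α (D.u t) := by
  have := Real.sin_sq_add_cos_sq (D.Θ t)
  have hQ := Real.mul_self_sqrt (D.Q_pos t).le
  rw [← D.sqrt_Q_mul_sin t, B]
  linear_combination √(Q D.α (D.u t)) ^ 2 * this + hQ

lemma hasDerivAt_θ (j : Fin 3) (t : ℝ) : HasDerivAt (D.θ j) (-(sgn j * D.A / D.ρ j t)) t := by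
  rw [← D.sqrt_Q_mul_sin t]
  exact D.deriv_θ j t

lemma contDiff_u_B (n : ℕ) : ContDiff ℝ n D.u ∧ ContDiff ℝ n D.B := by
  induction n with
  | zero =>
    exact ⟨contDiff_zero.2 D.continuous_u,
      contDiff_zero.2 (continuous_iff_continuousAt.2 fun t => (D.hasDerivAt_B t).continuousAt)⟩
  | succ n ih =>
    push_cast
    constructor
    · refine contDiff_succ_iff_deriv.2 ⟨fun t => (D.hasDerivAt_u t).differentiableAt, by simp, ?_⟩
      rw [funext fun t => (D.hasDerivAt_u t).deriv]
      exact contDiff_const.mul ih.2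
    · refine contDiff_succ_iff_deriv.2 ⟨fun t => (D.hasDerivAt_B t).differentiableAt, by simp, ?_⟩
      rw [funext fun t => (D.hasDerivAt_B t).deriv]
      exact ((contDiff_Q' D.α).of_le (by exact_mod_cast le_top)).comp ih.1

lemma contDiff_u : ContDiff ℝ ∞ D.u := contDiff_infty.2 fun n => (D.contDiff_u_B n).1

lemma contDiff_ρ (j : Fin 3) : ContDiff ℝ ∞ (D.ρ j) := by
  have := D.contDiff_u
  unfold ρ; fun_prop

lemma contDiff_θ (j : Fin 3) : ContDiff ℝ ∞ (D.θ j) := by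
  have h : ContDiff ℝ (∞ + 1) (D.θ j) := by
    refine contDiff_succ_iff_deriv.2 ⟨fun t => (D.hasDerivAt_θ j t).differentiableAt, by simp, ?_⟩
    rw [funext fun t => (D.hasDerivAt_θ j t).deriv]
    exact (contDiff_const.div (D.contDiff_ρ j) fun t => (D.ρ_pos j t).ne').neg
  exact h

/-- The solution is bounded, so the uniqueness of bounded solutions applies. -/
lemma exists_bound : ∃ R : ℝ, ∀ t, |D.u t| ≤ R ∧ |D.B t| ≤ R := by
  have a0 := D.α_pos 0
  have a1 := D.α_pos 1
  have a2 := D.α_pos 2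
  set M := (D.α 0 + D.α 1) * (D.α 0 + D.α 1) * (D.α 0 + D.α 2) with hM
  have hM0 : 0 < M := by positivity
  refine ⟨D.α 0 + D.α 1 + M + 1, fun t => ?_⟩
  have h0 := D.radius_pos 0 t
  have h1 := D.radius_pos 1 t
  have h2 := D.radius_pos 2 t
  simp only [sgn_zero, sgn_one, sgn_two, one_mul, neg_one_mul] at h0 h1 h2
  have hQ : Q D.α (D.u t) ≤ M := by
    rw [Q_eq, hM]
    gcongr <;> linarith
  have hB := D.A_sq_add_B_sq t
  constructor
  · rw [abs_le]; constructor <;> linarith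
  · have : |D.B t| ≤ M + 1 := by
      rw [← sq_abs (D.B t)] at hB
      nlinarith [sq_nonneg D.A, abs_nonneg (D.B t)]
    linarith

/-- If `u` and `B` agree at two times then the whole solution, up to constant rotations, repeats
itself. -/
lemma shift_of_eq {t t' : ℝ} (hu : D.u t' = D.u t) (hB : D.B t' = D.B t) (τ : ℝ) :
    D.u (t' + τ) = D.u (t + τ) ∧
      ∀ j, D.θ j (t' + τ) - D.θ j (t + τ) = D.θ j t' - D.θ j t := by
  obtain ⟨R, hR⟩ := D.exists_bound
  have key : ∀ τ, D.u (t' + τ) = D.u (t + τ) ∧ D.B (t' + τ) = D.B (t + τ) :=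
    eq_of_hamiltonian (α := D.α) (R := R)
      (u₁ := fun τ => D.u (t' + τ)) (B₁ := fun τ => D.B (t' + τ))
      (u₂ := fun τ => D.u (t + τ)) (B₂ := fun τ => D.B (t + τ))
      (fun τ => (D.hasDerivAt_u (t' + τ)).comp_const_add t' τ)
      (fun τ => (D.hasDerivAt_B (t' + τ)).comp_const_add t' τ)
      (fun τ => (D.hasDerivAt_u (t + τ)).comp_const_add t τ)
      (fun τ => (D.hasDerivAt_B (t + τ)).comp_const_add t τ)
      (fun _ => (hR _).1) (fun _ => (hR _).2) (fun _ => (hR _).1) (fun _ => (hR _).2)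
      (by simpa using hu) (by simpa using hB)
  refine ⟨(key τ).1, fun j => ?_⟩
  have hd : ∀ τ, HasDerivAt (fun τ => D.θ j (t' + τ) - D.θ j (t + τ)) 0 τ := fun τ => by
    refine (((D.hasDerivAt_θ j (t' + τ)).comp_const_add t' τ).sub
      ((D.hasDerivAt_θ j (t + τ)).comp_const_add t τ)).congr_deriv ?_
    simp [ρ, (key τ).1]
  simpa using is_const_of_deriv_eq_zero (fun τ => (hd τ).differentiableAt)
    (fun τ => (hd τ).deriv) τ 0

end Solution

/-! ### Coincidences between points of the evolving quadric -/

namespace Solution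

variable (D : Solution)

lemma point_apply (t : ℝ) (x : Fin 3 → ℝ) (j : Fin 3) : D.point t x j =
    (x j : ℂ) * Complex.exp (Complex.I * (D.θ j t : ℂ)) * ((√(D.ρ j t) : ℝ) : ℂ) := rfl

lemma norm_point_apply (t : ℝ) (x : Fin 3 → ℝ) (j : Fin 3) :
    ‖D.point t x j‖ = |x j| * √(D.ρ j t) := by
  rw [point_apply, norm_mul, norm_mul, mul_comm Complex.I, Complex.norm_exp_ofReal_mul_I,
    Complex.norm_real, Complex.norm_real, Real.norm_eq_abs, Real.norm_eq_abs,
    abs_of_nonneg (Real.sqrt_nonneg _), mul_one]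

lemma norm_point_apply_sq (t : ℝ) (x : Fin 3 → ℝ) (j : Fin 3) :
    ‖D.point t x j‖ ^ 2 = x j ^ 2 * D.ρ j t := by
  rw [norm_point_apply, mul_pow, sq_abs, Real.sq_sqrt (D.ρ_pos j t).le]

lemma point_apply_eq_zero {t : ℝ} {x : Fin 3 → ℝ} {j : Fin 3} : D.point t x j = 0 ↔ x j = 0 := by
  rw [← norm_eq_zero, norm_point_apply, mul_eq_zero, abs_eq_zero,
    or_iff_left (Real.sqrt_pos.2 (D.ρ_pos j t)).ne']

lemma point_neg (t : ℝ) (x : Fin 3 → ℝ) : D.point t (-x) = -D.point t x := by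
  ext j
  simp [point_apply]

/-- For fixed moduli `|zⱼ|`, the value of the quadratic form is strictly decreasing in `u`. -/
lemma u_le_of_point_eq {t t' : ℝ} {x x' : Fin 3 → ℝ} (h : D.point t x = D.point t' x')
    (h0 : x 0 ≠ 0) (hc : ∑ j, sgn j * x j ^ 2 = ∑ j, sgn j * x' j ^ 2) : D.u t' ≤ D.u t := by
  by_contra! hlt
  have hm : ∀ j, x j ^ 2 * D.ρ j t = x' j ^ 2 * D.ρ j t' := fun j => by
    rw [← norm_point_apply_sq, ← norm_point_apply_sq, h]
  simp only [Fin.sum_univ_three, sgn_zero, sgn_one, sgn_two] at hc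
  have r0 : D.ρ 0 t < D.ρ 0 t' := by simp [ρ, hlt]
  have r1 : D.ρ 1 t' < D.ρ 1 t := by simp [ρ]; linarith
  have r2 : D.ρ 2 t' < D.ρ 2 t := by simp [ρ]; linarith
  have e0 : x' 0 ^ 2 < x 0 ^ 2 := by
    have := hm 0
    have := D.ρ_pos 0 t
    have : 0 < x 0 ^ 2 := by positivity
    by_contra! hh
    nlinarith
  have e1 : x 1 ^ 2 ≤ x' 1 ^ 2 := by
    have := hm 1
    have := D.ρ_pos 1 t'
    by_contra! hh
    nlinarith [sq_nonneg (x 1)]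
  have e2 : x 2 ^ 2 ≤ x' 2 ^ 2 := by
    have := hm 2
    have := D.ρ_pos 2 t'
    by_contra! hh
    nlinarith [sq_nonneg (x 2)]
  linarith

lemma exists_phase_of_point_apply_eq {t t' : ℝ} {x x' : Fin 3 → ℝ} {j : Fin 3}
    (h : D.point t x j = D.point t' x' j) (hx : x j ≠ 0) :
    ∃ n : ℤ, D.θ j t' = D.θ j t + n * Real.pi := by
  have hx' : x' j ≠ 0 := fun h0 =>
    hx (D.point_apply_eq_zero.1 (h.trans (D.point_apply_eq_zero.2 h0)))
  have hr : √(D.ρ j t') ≠ 0 := (Real.sqrt_pos.2 (D.ρ_pos j t')).ne'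
  -- rotate the common value onto the real axis
  have h2 : (x j : ℂ) * (√(D.ρ j t) : ℝ) =
      x' j * Complex.exp (((D.θ j t' - D.θ j t : ℝ) : ℂ) * Complex.I) * (√(D.ρ j t') : ℝ) := by
    rw [point_apply, point_apply] at h
    have he : Complex.exp (((D.θ j t' - D.θ j t : ℝ) : ℂ) * Complex.I) =
        Complex.exp (Complex.I * D.θ j t') * Complex.exp (-(Complex.I * D.θ j t)) := by
      rw [← Complex.exp_add]; congr 1; push_cast; ring
    have h1 : Complex.exp (Complex.I * D.θ j t) * Complex.exp (-(Complex.I * D.θ j t)) = 1 := by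
      rw [← Complex.exp_add, add_neg_cancel, Complex.exp_zero]
    rw [he]
    linear_combination Complex.exp (-(Complex.I * D.θ j t)) * h - (x j : ℂ) * (√(D.ρ j t) : ℝ) * h1
  have h3 := congrArg Complex.im h2
  simp only [Complex.im_mul_ofReal, Complex.im_ofReal_mul, Complex.exp_ofReal_mul_I_im,
    Complex.ofReal_im, zero_mul, zero_eq_mul, hr, or_false] at h3
  obtain ⟨n, hn⟩ := Real.sin_eq_zero_iff.1 ((mul_eq_zero.1 h3).resolve_left hx')
  exact ⟨n, by linarith⟩

end Solution

namespace EvenPeriodicSolution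

variable (F : EvenPeriodicSolution)

lemma T_pos : 0 < F.T := F.period.1.1

lemma u_periodic : Function.Periodic F.u F.T := F.period.1.2.1

lemma Θ_periodic : Function.Periodic F.Θ F.T := F.period.1.2.2

lemma θ_add_int_mul (j : Fin 3) (t : ℝ) (k : ℤ) :
    F.θ j (t + k * F.T) = F.θ j t + k * (Real.pi * F.a j / F.b) := by
  induction k with
  | zero => simp
  | succ k ih =>
    have := F.shift j (t + k * F.T)
    push_cast at ih ⊢
    rw [show t + (k + 1) * F.T = t + k * F.T + F.T by ring, this, ih]
    ring
  | pred k ih =>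
    have := F.shift j (t + (-k - 1) * F.T)
    push_cast at ih ⊢
    rw [show t + (-k - 1) * F.T + F.T = t + -k * F.T by ring, ih] at this
    linarith

lemma sum_a : F.a 0 + F.a 1 + F.a 2 = 0 := by
  have h := F.Θ_periodic 0
  simp only [Solution.Θ, Fin.sum_univ_three, F.shift] at h
  have hb : (F.b : ℝ) ≠ 0 := by exact_mod_cast F.b_pos.ne'
  have h2 : Real.pi * (F.a 0 + F.a 1 + F.a 2) = 0 := by
    field_simp at h
    linarith
  have h3 := (mul_eq_zero.1 h2).resolve_left Real.pi_ne_zero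
  exact_mod_cast h3

/-- The common periods of `u` and `θ` are the integer multiples of the least one. -/
lemma exists_int_of_periodic {S : ℝ} (hu : Function.Periodic F.u S)
    (hΘ : Function.Periodic F.Θ S) : ∃ k : ℤ, S = k * F.T := by
  have hT := F.T_pos
  refine ⟨⌊S / F.T⌋, ?_⟩
  by_contra hne
  set k := ⌊S / F.T⌋
  have h1 : k * F.T ≤ S := (le_div_iff₀ hT).1 (Int.floor_le _)
  have h2 : S < k * F.T + F.T := by
    have := (div_lt_iff₀ hT).1 (Int.lt_floor_add_one (S / F.T))
    linarith
  have hmem := F.period.2 (show S - k * F.T ∈ _ from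
    ⟨sub_pos.2 (lt_of_le_of_ne h1 (Ne.symm hne)), hu.sub_period (F.u_periodic.int_mul k),
      hΘ.sub_period (F.Θ_periodic.int_mul k)⟩)
  linarith

/-- Generically, a point of `N` determines the time up to multiples of `bT`: its phases and moduli
give `θ` and `u`, hence the time up to a multiple `kT`, and the phases being known modulo `π`
forces `b ∣ k` by coprimality. -/
lemma exists_int_of_point_eq {t t' : ℝ} {x x' : Fin 3 → ℝ} (h : F.point t x = F.point t' x')
    (hx : ∀ j, x j ≠ 0) (hc : ∑ j, sgn j * x j ^ 2 = ∑ j, sgn j * x' j ^ 2) :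
    ∃ m : ℤ, t' = t + m * (F.b * F.T) := by
  have hx' : x' 0 ≠ 0 := fun h0 => hx 0 <| F.point_apply_eq_zero.1 <| by
    rw [h]; exact F.point_apply_eq_zero.2 h0
  have hu : F.u t' = F.u t :=
    le_antisymm (F.u_le_of_point_eq h (hx 0) hc) (F.u_le_of_point_eq h.symm hx' hc.symm)
  choose n hn using fun j => F.exists_phase_of_point_apply_eq (congrFun (congrArg _ h) j) (hx j)
  have hΘ : F.Θ t' = F.Θ t := by
    refine eq_of_sub_eq_int_mul_pi F.continuous_Θ F.sin_Θ_pos (n := n 0 + n 1 + n 2) ?_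
    simp only [Solution.Θ, Fin.sum_univ_three, hn]
    push_cast
    ring
  have hB : F.B t' = F.B t := by simp only [Solution.B, hu, hΘ]
  have hsh := F.shift_of_eq hu hB
  obtain ⟨k, hk⟩ := F.exists_int_of_periodic (S := t' - t)
    (fun τ => by
      rw [show τ + (t' - t) = t' + (τ - t) by ring, (hsh _).1]; congr 1; ring)
    (fun τ => by
      have h1 := fun j => (hsh (τ - t)).2 j
      have h2 : F.Θ (t' + (τ - t)) - F.Θ (t + (τ - t)) = F.Θ t' - F.Θ t := by
        simp only [Solution.Θ, ← Finset.sum_sub_distrib, h1]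
      rw [show τ + (t' - t) = t' + (τ - t) by ring]
      rw [hΘ, sub_self, sub_eq_zero, show t + (τ - t) = τ by ring] at h2
      exact h2)
  have ht' : t' = t + k * F.T := by linarith
  have hb : (F.b : ℝ) ≠ 0 := by exact_mod_cast F.b_pos.ne'
  have hdvd : ∀ j, (F.b : ℤ) ∣ k * F.a j := fun j => by
    have h1 := hn j
    rw [ht', F.θ_add_int_mul] at h1
    have h2 : Real.pi * (k * F.a j) = Real.pi * (F.b * n j) := by
      field_simp at h1
      linarith
    exact ⟨n j, by exact_mod_cast mul_left_cancel₀ Real.pi_ne_zero h2⟩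
  have hdvd' : F.b ∣ k.natAbs * Finset.univ.gcd fun j => (F.a j).natAbs := by
    have h1 : F.b ∣ Finset.univ.gcd fun j => k.natAbs * (F.a j).natAbs :=
      Finset.dvd_gcd fun j _ => by
        rw [← Int.natAbs_mul]
        exact Int.natCast_dvd.1 (hdvd j)
    rwa [Finset.gcd_mul_left, normalize_eq] at h1
  obtain ⟨m, hm⟩ := Int.natCast_dvd.2 (F.coprime.dvd_of_dvd_mul_right hdvd')
  refine ⟨m, ?_⟩
  rw [ht', hm]
  push_cast
  ring

end EvenPeriodicSolution

/-! ### Special Lagrangian planes -/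

lemma Omega_sum_smul (c : Matrix (Fin 3) (Fin 3) ℝ) (e : Fin 3 → C3) :
    Omega (fun i => ∑ k, c k i • e k) = c.det * Omega e := by
  have h : (Matrix.of fun i j => (∑ k, c k j • e k : C3) i) =
      (Matrix.of fun i j => e j i) * c.map (algebraMap ℝ ℂ) := by
    ext i j
    simp [Matrix.mul_apply, mul_comm]
  rw [Omega, h, Matrix.det_mul, ← RingHom.mapMatrix_apply, ← RingHom.map_det, mul_comm]
  rfl

/-- A 3-plane on which the Kähler form and `Im Ω` vanish is special Lagrangian: an orthonormal basis
is then unitary, so that its `Ω` is a real number of modulus one. -/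
lemma isSpecialLagrangianPlane_of {V : Submodule ℝ C3} (hV : Module.finrank ℝ V = 3)
    (hL : ∀ v ∈ V, ∀ w ∈ V, (∑ j, v j * star (w j)).im = 0)
    (hΩ : ∀ v : Fin 3 → C3, (∀ i, v i ∈ V) → (Omega v).im = 0) : IsSpecialLagrangianPlane V := by
  have : Fact (Module.finrank ℝ V = 3) := ⟨hV⟩
  let e : OrthonormalBasis (Fin 3) ℝ V := (stdOrthonormalBasis ℝ V).reindex (finCongr hV)
  let U : Matrix (Fin 3) (Fin 3) ℂ := Matrix.of fun i j => (e j : C3) i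
  have hU : U.conjTranspose * U = 1 := by
    ext i k
    rw [Matrix.mul_apply]
    apply Complex.ext
    · have h := e.inner_eq_ite i k
      rw [Submodule.coe_inner, PiLp.inner_apply] at h
      simp only [Complex.inner] at h
      rw [Matrix.one_apply, Complex.re_sum]
      convert h using 1
      · refine Finset.sum_congr rfl fun j _ => ?_
        simp [U, mul_comm]
      · split_ifs <;> rfl
    · have h := hL _ (e k).2 _ (e i).2
      simp only [mul_comm, star] at h
      rw [Matrix.one_apply]
      trans 0
      · exact h
      · split_ifs <;> simp
  have hdet : star U.det * U.det = 1 := by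
    rw [← Matrix.det_conjTranspose, ← Matrix.det_mul, hU, Matrix.det_one]
  have him : U.det.im = 0 := hΩ (fun i => (e i : C3)) fun i => (e i).2
  have hre : U.det.re = 1 ∨ U.det.re = -1 := by
    have h := congrArg Complex.re hdet
    simp [Complex.mul_re, him] at h
    exact mul_self_eq_one_iff.1 h
  have hv : ∀ v : Fin 3 → V, (Omega fun i => (v i : C3)).re = e.toBasis.det v * U.det.re := by
    intro v
    have h1 : (fun i => (v i : C3)) = fun i => ∑ k, e.toBasis.toMatrix v k i • (e k : C3) := by
      funext i
      have h := congrArg Subtype.val (e.toBasis.sum_repr (v i))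
      rw [AddSubmonoidClass.coe_finsetSum] at h
      exact h.symm
    rw [h1, Omega_sum_smul, Complex.re_ofReal_mul, Module.Basis.det_apply]
    rfl
  rcases hre with h | h
  · refine ⟨‹_›, e.toBasis.orientation, fun v => ?_⟩
    rw [hv, h, mul_one, Orientation.volumeForm_robust _ e rfl]
  · refine ⟨‹_›, -e.toBasis.orientation, fun v => ?_⟩
    rw [hv, h, mul_neg_one, Orientation.volumeForm_neg_orientation,
      Orientation.volumeForm_robust _ e rfl]
    rfl

lemma exists_volumeForm_eq_one {E : Type*} [NormedAddCommGroup E] [InnerProductSpace ℝ E]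
    [h : Fact (Module.finrank ℝ E = 3)] (o : Orientation ℝ E (Fin 3)) :
    ∃ v, o.volumeForm v = 1 := by
  let e := o.finOrthonormalBasis three_pos h.out
  refine ⟨e.toBasis, ?_⟩
  rw [o.volumeForm_robust e (o.finOrthonormalBasis_orientation _ _), Module.Basis.det_self]

/-- A special Lagrangian plane does not lie in a coordinate hyperplane `zⱼ = 0`, since `Ω`
vanishes on the latter. -/
lemma IsSpecialLagrangianPlane.exists_apply_ne_zero {V : Submodule ℝ C3}
    (h : IsSpecialLagrangianPlane V) (j : Fin 3) : ∃ v ∈ V, v j ≠ 0 := by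
  obtain ⟨hV, o, ho⟩ := h
  by_contra! hc
  obtain ⟨v, hv⟩ := exists_volumeForm_eq_one (E := V) o
  have h2 : Omega (fun i => (v i : C3)) = 0 :=
    Matrix.det_eq_zero_of_row_eq_zero j fun i => hc _ (v i).2
  have h1 := ho v
  rw [hv, h2] at h1
  exact zero_ne_one h1

/-- Being special Lagrangian depends on the tangent plane only, so `-Φ` is a special Lagrangian
immersion with `Φ`. -/
lemma IsSLImmersionAt.neg {E : Type*} [NormedAddCommGroup E] [NormedSpace ℝ E]
    {H : Type*} [TopologicalSpace H] {I : ModelWithCorners ℝ E H}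
    {M : Type*} [TopologicalSpace M] [ChartedSpace H M] {Φ : M → C3} {p : M}
    (h : IsSLImmersionAt I Φ p) : IsSLImmersionAt I (fun x => -Φ x) p := by
  have hd : HasMFDerivAt I 𝓘(ℝ, C3) (fun x => -Φ x) p (-(mfderiv I 𝓘(ℝ, C3) Φ p : E →L[ℝ] C3)) :=
    (h.smooth.mdifferentiableAt (by simp)).hasMFDerivAt.neg
  refine ⟨h.smooth.neg, ?_, ?_⟩
  · rw [hd.mfderiv]
    intro v w hvw
    exact h.injective (neg_injective hvw)
  · rw [hd.mfderiv]
    have : LinearMap.range (-(mfderiv I 𝓘(ℝ, C3) Φ p : E →L[ℝ] C3)).toLinearMap =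
        LinearMap.range (mfderiv I 𝓘(ℝ, C3) Φ p : E →L[ℝ] C3).toLinearMap :=
      LinearMap.range_neg _
    exact (congrArg IsSpecialLagrangianPlane this).mpr h.plane

/-! ### The tangent planes of the evolving quadric -/

/-- A determinant whose rows are multiples of a fixed complex vector, up to real vectors lying in a
plane. -/
lemma exists_det_eq (w : Fin 3 → ℂ) (τ m : Fin 3 → ℝ) (z : ℂ) {p : Matrix (Fin 3) (Fin 3) ℝ}
    (hp : p.det = 0) : ∃ R : ℝ, (Matrix.of fun i j => w j * (p i j + τ i * (m j : ℝ) * z)).det =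
      w 0 * w 1 * w 2 * z * R := by
  refine ⟨τ 0 * (m 0 * (p 1 1 * p 2 2 - p 1 2 * p 2 1) - m 1 * (p 1 0 * p 2 2 - p 1 2 * p 2 0) +
      m 2 * (p 1 0 * p 2 1 - p 1 1 * p 2 0)) -
    τ 1 * (m 0 * (p 0 1 * p 2 2 - p 0 2 * p 2 1) - m 1 * (p 0 0 * p 2 2 - p 0 2 * p 2 0) +
      m 2 * (p 0 0 * p 2 1 - p 0 1 * p 2 0)) +
    τ 2 * (m 0 * (p 0 1 * p 1 2 - p 0 2 * p 1 1) - m 1 * (p 0 0 * p 1 2 - p 0 2 * p 1 0) +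
      m 2 * (p 0 0 * p 1 1 - p 0 1 * p 1 0)), ?_⟩
  have h := congrArg (fun r : ℝ => (r : ℂ)) hp
  rw [Matrix.det_fin_three] at h ⊢
  simp only [Matrix.of_apply]
  push_cast at h ⊢
  linear_combination (w 0 * w 1 * w 2) * h

namespace Solution

variable (D : Solution)

/-- The coefficient `wⱼ = e^{iθⱼ} ρⱼ^{1/2}` of the evolving quadric `{(x₁w₁, x₂w₂, x₃w₃)}`. -/
def w (j : Fin 3) (t : ℝ) : ℂ := Complex.exp (Complex.I * (D.θ j t : ℂ)) * ((√(D.ρ j t) : ℝ) : ℂ)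

lemma point_apply_eq_mul_w (t : ℝ) (x : Fin 3 → ℝ) (j : Fin 3) :
    D.point t x j = x j * D.w j t := by
  rw [point_apply, w, mul_assoc]

lemma w_ne_zero (j : Fin 3) (t : ℝ) : D.w j t ≠ 0 :=
  mul_ne_zero (Complex.exp_ne_zero _)
    (Complex.ofReal_ne_zero.2 (Real.sqrt_pos.2 (D.ρ_pos j t)).ne')

lemma w_mul_star (j : Fin 3) (t : ℝ) : D.w j t * star (D.w j t) = D.ρ j t := by
  have h := D.norm_point_apply_sq t (fun _ => 1) j
  rw [point_apply_eq_mul_w] at h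
  simp only [Complex.ofReal_one, one_mul, one_pow] at h
  rw [← h, Complex.ofReal_pow]
  exact Complex.mul_conj' _

lemma w_prod (t : ℝ) : D.w 0 t * D.w 1 t * D.w 2 t = D.B t + Complex.I * D.A := by
  have h1 : Complex.exp (Complex.I * (D.θ 0 t : ℂ)) * Complex.exp (Complex.I * (D.θ 1 t : ℂ)) *
      Complex.exp (Complex.I * (D.θ 2 t : ℂ)) =
        Real.cos (D.Θ t) + Real.sin (D.Θ t) * Complex.I := by
    rw [← Complex.exp_add, ← Complex.exp_add, Complex.ofReal_cos, Complex.ofReal_sin,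
      ← Complex.exp_mul_I]
    congr 1
    simp only [Θ, Fin.sum_univ_three]
    push_cast
    ring
  have h2 : √(Q D.α (D.u t)) = √(D.ρ 0 t) * √(D.ρ 1 t) * √(D.ρ 2 t) := by
    rw [Q_eq_prod_ρ, Real.sqrt_mul (mul_pos (D.ρ_pos 0 t) (D.ρ_pos 1 t)).le,
      Real.sqrt_mul (D.ρ_pos 0 t).le]
  rw [← D.sqrt_Q_mul_sin t, B, h2]
  simp only [w]
  push_cast at h1 ⊢
  linear_combination (√(D.ρ 0 t) * √(D.ρ 1 t) * √(D.ρ 2 t) : ℂ) * h1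

lemma hasDerivAt_w (j : Fin 3) (t : ℝ) :
    HasDerivAt (D.w j) (D.w j t * (sgn j * (D.B t - Complex.I * D.A) / D.ρ j t)) t := by
  have h1 := (((D.hasDerivAt_θ j t).ofReal_comp).const_mul Complex.I).cexp
  have h2 : HasDerivAt (D.ρ j) (sgn j * (2 * D.B t)) t :=
    ((D.hasDerivAt_u t).const_mul _).const_add _
  have h3 := (h2.sqrt (D.ρ_pos j t).ne').ofReal_comp
  refine (h1.mul h3).congr_deriv ?_
  have hr : (√(D.ρ j t) : ℂ) ≠ 0 := Complex.ofReal_ne_zero.2 (Real.sqrt_pos.2 (D.ρ_pos j t)).ne'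
  have hs : (D.ρ j t : ℂ) = √(D.ρ j t) * √(D.ρ j t) := by
    rw [← Complex.ofReal_mul, Real.mul_self_sqrt (D.ρ_pos j t).le]
  simp only [w]
  push_cast
  rw [hs]
  field_simp
  ring

lemma contDiff_w (j : Fin 3) : ContDiff ℝ ∞ (D.w j) := by
  have h1 := D.contDiff_θ j
  have h2 : ContDiff ℝ ∞ fun t => √(D.ρ j t) := (D.contDiff_ρ j).sqrt fun t => (D.ρ_pos j t).ne'
  have h3 : ContDiff ℝ ∞ fun t => ((D.θ j t : ℝ) : ℂ) := Complex.ofRealCLM.contDiff.comp h1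
  have h4 : ContDiff ℝ ∞ fun t => ((√(D.ρ j t) : ℝ) : ℂ) := Complex.ofRealCLM.contDiff.comp h2
  exact (contDiff_const.mul h3).cexp.mul h4

lemma contDiff_point : ContDiff ℝ ∞ fun p : ℝ × (Fin 3 → ℝ) => D.point p.1 p.2 := by
  refine contDiff_piLp' 2 fun j => ?_
  simp only [point_apply_eq_mul_w]
  have h := D.contDiff_w j
  have h1 : ContDiff ℝ ∞ fun p : ℝ × (Fin 3 → ℝ) => ((p.2 j : ℝ) : ℂ) :=
    Complex.ofRealCLM.contDiff.comp (by fun_prop)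
  exact h1.mul (h.comp contDiff_fst)

/-- The differential of `(t, x) ↦ point t x`. -/
lemma fderiv_point_apply (t : ℝ) (x : Fin 3 → ℝ) (y : ℝ × (Fin 3 → ℝ)) (j : Fin 3) :
    fderiv ℝ (fun p : ℝ × (Fin 3 → ℝ) => D.point p.1 p.2) (t, x) y j =
      D.w j t * (y.2 j + y.1 * (sgn j * x j / D.ρ j t : ℝ) * (D.B t - Complex.I * D.A)) := by
  have h0 : HasFDerivAt (fun p : ℝ × (Fin 3 → ℝ) => D.point p.1 p.2) _ (t, x) :=
    (D.contDiff_point.differentiable (by simp) (t, x)).hasFDerivAt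
  have h1 := (PiLp.hasFDerivAt_apply (𝕜 := ℝ) 2 (D.point t x) j).comp (t, x) h0
  have h2 : HasFDerivAt (fun p : ℝ × (Fin 3 → ℝ) => ((p.2 j : ℝ) : ℂ)) _ (t, x) :=
    (Complex.ofRealCLM.comp ((ContinuousLinearMap.proj (R := ℝ) (φ := fun _ => ℝ) j).comp
      (ContinuousLinearMap.snd ℝ ℝ (Fin 3 → ℝ)))).hasFDerivAt
  have h3 := HasFDerivAt.comp (t, x) (f := (Prod.fst : ℝ × (Fin 3 → ℝ) → ℝ))
    (D.hasDerivAt_w j t).hasFDerivAt (hasFDerivAt_fst (𝕜 := ℝ))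
  have h4 := h2.mul h3
  have h5 : ((fun z : C3 => z j) ∘ fun p : ℝ × (Fin 3 → ℝ) => D.point p.1 p.2) =
      fun p => ((p.2 j : ℝ) : ℂ) * D.w j p.1 := funext fun p => D.point_apply_eq_mul_w _ _ _
  rw [h5] at h1
  have h6 := congrArg (fun L => L y) (h1.unique h4)
  simp at h6
  rw [h6]
  push_cast
  ring

/-- The differential of `(t, x) ↦ point t x` is injective for `x ≠ 0`, because `A ≠ 0`. -/
lemma fderiv_point_injective (t : ℝ) {x : Fin 3 → ℝ} (hx : x ≠ 0) : Function.Injective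
    (fderiv ℝ (fun p : ℝ × (Fin 3 → ℝ) => D.point p.1 p.2) (t, x)) := by
  rw [injective_iff_map_eq_zero]
  intro y hy
  have h : ∀ j, (y.2 j + y.1 * (sgn j * x j / D.ρ j t : ℝ) * (D.B t - Complex.I * D.A) : ℂ) = 0 :=
    fun j => by
      have := D.fderiv_point_apply t x y j
      rw [hy] at this
      exact (mul_eq_zero.1 this.symm).resolve_left (D.w_ne_zero j t)
  have h0 : y.1 = 0 := by
    obtain ⟨j, hj⟩ := Function.ne_iff.1 hx
    have h1 := congrArg Complex.im (h j)
    rw [← Complex.ofReal_mul] at h1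
    simp only [Complex.add_im, Complex.ofReal_im, Complex.im_ofReal_mul, Complex.sub_im,
      Complex.im_mul_ofReal, Complex.I_im, Complex.zero_im] at h1
    have hs : sgn j ≠ 0 := by fin_cases j <;> simp
    have h2 : sgn j * x j / D.ρ j t ≠ 0 := div_ne_zero (mul_ne_zero hs hj) (D.ρ_pos j t).ne'
    have h3 := D.A_pos'.ne'
    by_contra hne
    exact mul_ne_zero (mul_ne_zero hne h2) h3 (by linarith)
  refine Prod.ext h0 (funext fun j => ?_)
  have := h j
  simpa [h0] using this

/-- The vectors tangent to the quadric at `x`, together with `∂/∂t`, span a plane on which the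
Kähler form and `Im Ω` vanish. -/
lemma isSpecialLagrangianPlane_range {E : Type*} [NormedAddCommGroup E] [NormedSpace ℝ E]
    (hE : Module.finrank ℝ E = 3) (t : ℝ) {x : Fin 3 → ℝ} (hx : x ≠ 0)
    (G : E →L[ℝ] ℝ × (Fin 3 → ℝ)) (hG : Function.Injective G)
    (hc : ∀ v, ∑ j, sgn j * x j * (G v).2 j = 0) :
    IsSpecialLagrangianPlane (LinearMap.range
      ((fderiv ℝ (fun p : ℝ × (Fin 3 → ℝ) => D.point p.1 p.2) (t, x)).comp G).toLinearMap) := by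
  have hr : ∀ j, D.ρ j t ≠ 0 := fun j => (D.ρ_pos j t).ne'
  apply isSpecialLagrangianPlane_of
  · rw [LinearMap.finrank_range_of_inj, hE]
    exact (D.fderiv_point_injective t hx).comp hG
  · rintro _ ⟨v, rfl⟩ _ ⟨v', rfl⟩
    have h1 := hc v
    have h2 := hc v'
    have key : ∀ j, ((fderiv ℝ (fun p : ℝ × (Fin 3 → ℝ) => D.point p.1 p.2) (t, x)) (G v) j *
        star ((fderiv ℝ (fun p : ℝ × (Fin 3 → ℝ) => D.point p.1 p.2) (t, x)) (G v') j)).im =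
        D.A * (sgn j * x j * (G v).2 j * (G v').1 - sgn j * x j * (G v').2 j * (G v).1) := by
      intro j
      rw [fderiv_point_apply, fderiv_point_apply, star_mul', mul_mul_mul_comm, w_mul_star,
        Complex.im_ofReal_mul]
      have := hr j
      simp [Complex.add_im, Complex.mul_im]
      field_simp
      ring
    rw [Complex.im_sum]
    refine (Finset.sum_congr rfl fun j _ => key j).trans ?_
    rw [← Finset.mul_sum, Finset.sum_sub_distrib, ← Finset.sum_mul, ← Finset.sum_mul, h1, h2]
    simp
  · intro v hv
    choose y hy using hv
    -- the quadric directions of three tangent vectors are linearly dependent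
    have hdet : (Matrix.of fun i j => (G (y i)).2 j).det = 0 := by
      refine Matrix.exists_mulVec_eq_zero_iff.1 ⟨fun j => sgn j * x j, ?_, ?_⟩
      · obtain ⟨j, hj⟩ := Function.ne_iff.1 hx
        have hs : sgn j ≠ 0 := by fin_cases j <;> simp
        exact Function.ne_iff.2 ⟨j, mul_ne_zero hs hj⟩
      · funext i
        have := hc (y i)
        simp only [Matrix.mulVec, dotProduct, Matrix.of_apply, Pi.zero_apply]
        rw [← this]
        exact Finset.sum_congr rfl fun j _ => mul_comm _ _
    have hv : ∀ i j, v i j = D.w j t * ((G (y i)).2 j +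
        (G (y i)).1 * (sgn j * x j / D.ρ j t : ℝ) * (D.B t - Complex.I * D.A)) := fun i j => by
      rw [← hy i]; exact D.fderiv_point_apply t x _ j
    obtain ⟨R, hR⟩ := exists_det_eq (fun j => D.w j t) (fun i => (G (y i)).1)
      (fun j => sgn j * x j / D.ρ j t) (D.B t - Complex.I * D.A) hdet
    simp only [Omega, hv]
    rw [← Matrix.det_transpose]
    refine (congrArg Complex.im hR).trans ?_
    rw [D.w_prod t, show (D.B t + Complex.I * D.A) * (D.B t - Complex.I * D.A) * R =
      ((D.B t ^ 2 + D.A ^ 2) * R : ℝ) by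
        push_cast; linear_combination (-(D.A : ℂ) ^ 2 * R) * Complex.I_mul_I, Complex.ofReal_im]

section

variable {E : Type*} [NormedAddCommGroup E] [NormedSpace ℝ E]
  {H : Type*} [TopologicalSpace H] {I : ModelWithCorners ℝ E H}
  {M : Type*} [TopologicalSpace M] [ChartedSpace H M]

/-- A map into the evolving quadric whose coordinates `(t, x)` form an immersion is a special
Lagrangian immersion away from `x = 0`. -/
lemma isSLImmersionAt (hE : Module.finrank ℝ E = 3) {Φ : M → C3} {g : M → ℝ × (Fin 3 → ℝ)}
    {p : M} {c : ℝ} (hg : ContMDiffAt I 𝓘(ℝ, ℝ × (Fin 3 → ℝ)) ∞ g p)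
    (hΦ : Φ =ᶠ[𝓝 p] fun m => D.point (g m).1 (g m).2) (hx : (g p).2 ≠ 0)
    (hc : ∀ᶠ m in 𝓝 p, ∑ j, sgn j * (g m).2 j ^ 2 = c)
    (hinj : Function.Injective (mfderiv I 𝓘(ℝ, ℝ × (Fin 3 → ℝ)) g p)) :
    IsSLImmersionAt I Φ p := by
  have hgd := (hg.mdifferentiableAt (by simp)).hasMFDerivAt
  have hP : ContMDiffAt 𝓘(ℝ, ℝ × (Fin 3 → ℝ)) 𝓘(ℝ, C3) ∞
      (fun p : ℝ × (Fin 3 → ℝ) => D.point p.1 p.2) (g p) := D.contDiff_point.contMDiff _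
  have hPd := (D.contDiff_point.differentiable (by simp) (g p)).hasFDerivAt.hasMFDerivAt
  have hd : mfderiv I 𝓘(ℝ, C3) Φ p =
      (fderiv ℝ (fun p : ℝ × (Fin 3 → ℝ) => D.point p.1 p.2) (g p)).comp
        (mfderiv I 𝓘(ℝ, ℝ × (Fin 3 → ℝ)) g p : E →L[ℝ] ℝ × (Fin 3 → ℝ)) :=
    ((hPd.comp p hgd).congr_of_eventuallyEq hΦ).mfderiv
  refine ⟨(hP.comp p hg).congr_of_eventuallyEq hΦ, ?_, ?_⟩
  · rw [hd]
    exact (D.fderiv_point_injective (g p).1 hx).comp hinj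
  · rw [hd]
    refine D.isSpecialLagrangianPlane_range hE (g p).1 hx _ hinj fun v => ?_
    set dg : E →L[ℝ] ℝ × (Fin 3 → ℝ) := mfderiv I 𝓘(ℝ, ℝ × (Fin 3 → ℝ)) g p
    let e (j : Fin 3) : ℝ × (Fin 3 → ℝ) →L[ℝ] ℝ :=
      (ContinuousLinearMap.proj (R := ℝ) (φ := fun _ => ℝ) j).comp
        (ContinuousLinearMap.snd ℝ ℝ (Fin 3 → ℝ))
    have hq : HasFDerivAt (fun y : ℝ × (Fin 3 → ℝ) => ∑ j, sgn j * y.2 j ^ 2)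
        (∑ j, (sgn j * (2 * (g p).2 j)) • e j) (g p) := by
      refine HasFDerivAt.fun_sum fun j _ => ?_
      refine (((e j).hasFDerivAt.pow 2).const_mul (sgn j)).congr_fderiv ?_
      ext y <;> simp [e, mul_assoc]
    have h1 := (hq.hasMFDerivAt.comp p hgd).mfderiv
    have h2 := ((hasMFDerivAt_const c p (I := I) (I' := 𝓘(ℝ, ℝ))).congr_of_eventuallyEq hc).mfderiv
    have h3 := congrArg (fun L : E →L[ℝ] ℝ => L v) (h1.symm.trans h2)
    have h4 : (∑ j, (sgn j * (2 * (g p).2 j)) • e j) (dg v) = 0 := h3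
    rw [sum_apply] at h4
    have h5 : (2 : ℝ) * ∑ j, sgn j * (g p).2 j * (dg v).2 j = 0 := by
      rw [← h4, Finset.mul_sum]
      refine Finset.sum_congr rfl fun j _ => ?_
      simp only [e, smul_apply, ContinuousLinearMap.comp_apply,
        ContinuousLinearMap.coe_snd', ContinuousLinearMap.proj_apply, smul_eq_mul]
      ring
    linarith

end

end Solution

/-! ### The circle as a manifold -/

lemma contMDiff_circle_coe : ContMDiff (𝓡 1) 𝓘(ℝ, ℂ) ∞ fun q : Circle => (q : ℂ) := by
  have := finrank_real_complex_fact'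
  exact contMDiff_coe_sphere (E := ℂ) (n := 1)

lemma mfderiv_circle_coe_injective (q : Circle) :
    Function.Injective (mfderiv (𝓡 1) 𝓘(ℝ, ℂ) (fun q : Circle => (q : ℂ)) q) := by
  have := finrank_real_complex_fact'
  exact injective_mvfderiv_subtypeVal_sphere (E := ℂ) (n := 1) q

/-- Near every point of the circle there is a smooth choice of the argument. -/
lemma exists_smooth_arg (q₀ : Circle) : ∃ l : Circle → ℝ,
    ContMDiffAt (𝓡 1) 𝓘(ℝ, ℝ) ∞ l q₀ ∧ ∀ q, Circle.exp (l q) = q := by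
  refine ⟨fun q => Complex.arg q₀ + Complex.arg (q / q₀ : Circle), ?_, fun q => ?_⟩
  · have h1 : ContDiffAt ℝ ∞ (fun z : ℂ => Complex.arg q₀ + (Complex.log (z / q₀)).im) q₀ := by
      have h2 : ContDiffAt ℝ ∞ (fun z : ℂ => z / (q₀ : ℂ)) q₀ := by fun_prop
      have h3 : ContDiffAt ℝ ∞ Complex.log ((q₀ : ℂ) / q₀) := by
        rw [div_self q₀.coe_ne_zero]
        exact (Complex.contDiffAt_log Complex.one_mem_slitPlane).restrict_scalars ℝ
      have h4 : ContDiffAt ℝ ∞ (fun z : ℂ => Complex.log (z / q₀)) q₀ :=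
        ContDiffAt.comp (g := Complex.log) (q₀ : ℂ) h3 h2
      exact contDiffAt_const.add (Complex.imCLM.contDiff.contDiffAt.comp _ h4)
    refine (h1.contMDiffAt.comp q₀ (contMDiff_circle_coe q₀)).congr_of_eventuallyEq ?_
    exact Filter.Eventually.of_forall fun q => by
      change _ = Complex.arg q₀ + (Complex.log ((q : ℂ) / q₀)).im
      rw [Complex.log_im]
      exact congrArg (fun z : ℂ => Complex.arg q₀ + Complex.arg z) (Circle.coe_div q q₀)
  · rw [Circle.exp_add, Circle.exp_arg, Circle.exp_arg, mul_div_cancel]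

/-! ### The evolving quadric over the circle of times -/

lemma exp_int_mul_pi (n : ℤ) : Complex.exp (Complex.I * (n * Real.pi)) = ((-1 : ℝ) ^ n : ℝ) := by
  rw [show Complex.I * (n * Real.pi) = n * (Real.pi * Complex.I) by ring, Complex.exp_int_mul,
    Complex.exp_pi_mul_I]
  push_cast
  rfl

namespace EvenPeriodicSolution

variable (F : EvenPeriodicSolution)

/-- The factor between the angular time `s`, of period `2π`, and the time `t`, of period `bT`. -/
def κ : ℝ := F.b * F.T / (2 * Real.pi)

/-- The rotation of the `(x₂, x₃)`-plane which undoes, after the time `bT`, the signs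
`(-1)^{a₂} = (-1)^{a₃}` acquired by the coefficients of `x₂` and `x₃`. -/
def twist (s : ℝ) : ℂ := Complex.exp (Complex.I * (F.a 1 * (s / 2) : ℝ))

/-- The time and the position on the quadric with angular time `s` and with coordinates `x₁ = ξ`,
`x₂ + i x₃ = ζ`, the latter in the rotating frame. -/
def coord (s : ℝ) (ζ : ℂ) (ξ : ℝ) : ℝ × (Fin 3 → ℝ) :=
  (F.κ * s, ![ξ, (F.twist s * ζ).re, (F.twist s * ζ).im])

/-- The point of `ℂ³` with given angular time and position on the quadric. -/
def sweep (q : Circle) (ζ : ℂ) (ξ : ℝ) : C3 :=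
  F.point (F.coord (Complex.arg q) ζ ξ).1 (F.coord (Complex.arg q) ζ ξ).2

lemma κ_pos : 0 < F.κ := by
  have h1 : (0 : ℝ) < F.b := by exact_mod_cast F.b_pos
  have h2 := F.T_pos
  have h3 := Real.pi_pos
  unfold κ; positivity

lemma norm_twist (s : ℝ) : ‖F.twist s‖ = 1 := by
  rw [twist, mul_comm, Complex.norm_exp_ofReal_mul_I]

lemma star_twist_mul_twist (s : ℝ) : star (F.twist s) * F.twist s = 1 := by
  have h := Complex.conj_mul' (F.twist s)
  rw [norm_twist] at h
  simpa using h

lemma w_add (j : Fin 3) (t : ℝ) (m : ℤ) :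
    F.w j (t + m * (F.b * F.T)) = ((-1 : ℝ) ^ (m * F.a j) : ℝ) * F.w j t := by
  have hb : (F.b : ℝ) ≠ 0 := by exact_mod_cast F.b_pos.ne'
  have h1 : t + m * (F.b * F.T) = t + (m * F.b : ℤ) * F.T := by push_cast; ring
  have h2 : F.ρ j (t + (m * F.b : ℤ) * F.T) = F.ρ j t := by
    rw [Solution.ρ, F.u_periodic.int_mul (m * F.b) t, Solution.ρ]
  rw [Solution.w, h1, h2, F.θ_add_int_mul, ← exp_int_mul_pi, Solution.w, ← mul_assoc,
    ← Complex.exp_add]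
  congr 2
  push_cast
  have hb' : (F.b : ℂ) ≠ 0 := by exact_mod_cast hb
  field_simp
  ring

lemma neg_one_zpow_mul_a_zero (m : ℤ) : ((-1 : ℝ) ^ (m * F.a 0)) = 1 :=
  (F.even.mul_left m).neg_one_zpow

lemma neg_one_zpow_mul_a_two (m : ℤ) : ((-1 : ℝ) ^ (m * F.a 2)) = (-1) ^ (m * F.a 1) := by
  have h : m * F.a 2 = m * F.a 1 + (-(m * F.a 0) - 2 * (m * F.a 1)) := by
    linear_combination m * F.sum_a
  have h2 : Even (-(m * F.a 0) - 2 * (m * F.a 1)) :=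
    (F.even.mul_left m).neg.sub (even_two_mul _)
  rw [h, zpow_add₀ (by norm_num), h2.neg_one_zpow, mul_one]

lemma point_coord_add (s : ℝ) (m : ℤ) (ζ : ℂ) (ξ : ℝ) :
    F.point (F.coord (s + m * (2 * Real.pi)) ζ ξ).1 (F.coord (s + m * (2 * Real.pi)) ζ ξ).2 =
      F.point (F.coord s ζ ξ).1 (F.coord s ζ ξ).2 := by
  have ht : F.κ * (s + m * (2 * Real.pi)) = F.κ * s + m * (F.b * F.T) := by
    have := Real.pi_ne_zero
    unfold κ; field_simp
  have htw : F.twist (s + m * (2 * Real.pi)) = ((-1 : ℝ) ^ (m * F.a 1) : ℝ) * F.twist s := by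
    rw [twist, twist, ← exp_int_mul_pi, ← Complex.exp_add]
    congr 1
    push_cast
    ring
  have hsq : ((-1 : ℝ) ^ (m * F.a 1)) * (-1 : ℝ) ^ (m * F.a 1) = 1 := by
    rw [← zpow_add₀ (by norm_num), (Even.add_self _).neg_one_zpow]
  ext j
  rw [Solution.point_apply_eq_mul_w, Solution.point_apply_eq_mul_w]
  simp only [coord, ht, w_add, htw, mul_assoc, Complex.re_ofReal_mul, Complex.im_ofReal_mul]
  have hsq' := congrArg (fun r : ℝ => (r : ℂ)) hsq
  simp only [Complex.ofReal_mul, Complex.ofReal_one] at hsq'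
  fin_cases j
  · simp [neg_one_zpow_mul_a_zero, -Complex.ofReal_zpow]
  · simp [-Complex.ofReal_zpow, -Complex.mul_re]
    linear_combination ((F.twist s * ζ).re * F.w 1 (F.κ * s)) * hsq'
  · simp [neg_one_zpow_mul_a_two, -Complex.ofReal_zpow, -Complex.mul_im]
    linear_combination ((F.twist s * ζ).im * F.w 2 (F.κ * s)) * hsq'

lemma sweep_eq {q : Circle} {s : ℝ} (h : Circle.exp s = q) (ζ : ℂ) (ξ : ℝ) :
    F.sweep q ζ ξ = F.point (F.coord s ζ ξ).1 (F.coord s ζ ξ).2 := by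
  obtain ⟨m, hm⟩ := Circle.exp_eq_exp.1 (h.trans (Circle.exp_arg q).symm)
  rw [hm, point_coord_add, sweep]

lemma sum_sgn_coord (s : ℝ) (ζ : ℂ) (ξ : ℝ) :
    ∑ j, sgn j * (F.coord s ζ ξ).2 j ^ 2 = ξ ^ 2 - ‖ζ‖ ^ 2 := by
  have h : ‖F.twist s * ζ‖ ^ 2 = ‖ζ‖ ^ 2 := by rw [norm_mul, norm_twist, one_mul]
  rw [← h, ← Complex.normSq_eq_norm_sq, Complex.normSq_apply]
  simp [coord, Fin.sum_univ_three]
  ring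

/-- Every point of the evolving quadric is attained by `sweep`. -/
lemma exists_sweep_eq (t : ℝ) (x : Fin 3 → ℝ) : ∃ (q : Circle) (ζ : ℂ),
    F.point t x = F.sweep q ζ (x 0) ∧ x 0 ^ 2 - ‖ζ‖ ^ 2 = ∑ j, sgn j * x j ^ 2 := by
  have hc : F.coord (t / F.κ) (star (F.twist (t / F.κ)) * ⟨x 1, x 2⟩) (x 0) = (t, x) := by
    have := F.κ_pos.ne'
    refine Prod.ext (by simp only [coord]; field_simp) ?_
    simp only [coord]
    rw [← mul_assoc, mul_comm (F.twist _) (star _), star_twist_mul_twist, one_mul]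
    ext j; fin_cases j <;> rfl
  refine ⟨Circle.exp (t / F.κ), star (F.twist (t / F.κ)) * ⟨x 1, x 2⟩, ?_, ?_⟩
  · rw [F.sweep_eq rfl, hc]
  · rw [← F.sum_sgn_coord (t / F.κ), hc]

/-- `sweep` is injective where all coordinates are nonzero. -/
lemma sweep_inj {q q' : Circle} {ζ ζ' : ℂ} {ξ ξ' : ℝ} (h : F.sweep q' ζ' ξ' = F.sweep q ζ ξ)
    (h0 : ∀ j, F.sweep q ζ ξ j ≠ 0) (hc : ξ ^ 2 - ‖ζ‖ ^ 2 = ξ' ^ 2 - ‖ζ'‖ ^ 2) :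
    q' = q ∧ ζ' = ζ ∧ ξ' = ξ := by
  obtain ⟨m, hm⟩ := F.exists_int_of_point_eq h.symm
    (fun j hj => h0 j (F.point_apply_eq_zero.2 hj)) (by rw [sum_sgn_coord, sum_sgn_coord, hc])
  have hs : Complex.arg q' = Complex.arg q + m * (2 * Real.pi) := by
    have h1 := F.κ_pos.ne'
    have h2 := Real.pi_ne_zero
    have h3 : F.κ * Complex.arg q' = F.κ * (Complex.arg q + m * (2 * Real.pi)) := by
      refine hm.trans ?_
      rw [mul_add]
      congr 1
      unfold κ
      field_simp
    exact mul_left_cancel₀ h1 h3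
  have hq : q' = q := by
    rw [← Circle.exp_arg q', ← Circle.exp_arg q]
    exact Circle.exp_eq_exp.2 ⟨m, hs⟩
  subst hq
  have hx : ∀ j, (F.coord (Complex.arg q') ζ' ξ').2 j = (F.coord (Complex.arg q') ζ ξ).2 j :=
    fun j => by
      have h1 := congrFun (congrArg WithLp.ofLp h) j
      rw [sweep, sweep, Solution.point_apply_eq_mul_w, Solution.point_apply_eq_mul_w] at h1
      exact_mod_cast mul_right_cancel₀ (F.w_ne_zero j _) h1
  refine ⟨rfl, ?_, hx 0⟩
  have h1 : F.twist (Complex.arg q') * ζ' = F.twist (Complex.arg q') * ζ :=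
    Complex.ext (hx 1) (hx 2)
  have h2 := F.star_twist_mul_twist (Complex.arg q')
  linear_combination star (F.twist (Complex.arg q')) * h1 - (ζ' - ζ) * h2

end EvenPeriodicSolution

/-! ### Immersions swept out by the evolving quadric -/

section

variable {E : Type*} [NormedAddCommGroup E] [NormedSpace ℝ E]
  {H : Type*} [TopologicalSpace H] {I : ModelWithCorners ℝ E H}
  {M : Type*} [TopologicalSpace M] [ChartedSpace H M]
  {E' : Type*} [NormedAddCommGroup E'] [NormedSpace ℝ E']

namespace EvenPeriodicSolution

variable (F : EvenPeriodicSolution)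

lemma contDiff_coord : ContDiff ℝ ∞ fun y : ℝ × ℂ × ℝ => F.coord y.1 y.2.1 y.2.2 := by
  have ht : ContDiff ℝ ∞ fun y : ℝ × ℂ × ℝ => F.twist y.1 * y.2.1 := by
    have h0 : ContDiff ℝ ∞ fun y : ℝ × ℂ × ℝ => (F.a 1 : ℝ) * (y.1 / 2) := by fun_prop
    have h1 : ContDiff ℝ ∞ fun y : ℝ × ℂ × ℝ => ((F.a 1 * (y.1 / 2) : ℝ) : ℂ) :=
      Complex.ofRealCLM.contDiff.comp h0
    exact (contDiff_const.mul h1).cexp.mul (by fun_prop)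
  refine ContDiff.prodMk (by fun_prop) (contDiff_pi.2 fun j => ?_)
  fin_cases j
  · exact contDiff_snd.comp contDiff_snd
  · exact Complex.reCLM.contDiff.comp ht
  · exact Complex.imCLM.contDiff.comp ht

lemma contMDiffAt_sweep {k₁ : M → Circle} {k₂ : M → ℂ} {k₃ : M → ℝ} {p : M}
    (h₁ : ContMDiffAt I (𝓡 1) ∞ k₁ p) (h₂ : ContMDiffAt I 𝓘(ℝ, ℂ) ∞ k₂ p)
    (h₃ : ContMDiffAt I 𝓘(ℝ, ℝ) ∞ k₃ p) :
    ContMDiffAt I 𝓘(ℝ, C3) ∞ (fun m => F.sweep (k₁ m) (k₂ m) (k₃ m)) p := by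
  obtain ⟨l, hl, hl'⟩ := exists_smooth_arg (k₁ p)
  have h := ContMDiffAt.comp p
    ((F.contDiff_point.comp F.contDiff_coord).contMDiff (l (k₁ p), k₂ p, k₃ p))
    ((ContMDiffAt.comp p hl h₁).prodMk_space (h₂.prodMk_space h₃))
  exact h.congr_of_eventuallyEq (Filter.Eventually.of_forall fun m => F.sweep_eq (hl' _) _ _)

/-- A map into the evolving quadric is a special Lagrangian immersion if its coordinates `q`, `ζ`,
`ξ`, and its value, determine an immersion `ι` into a vector space. -/
lemma isSLImmersionAt_sweep (hE : Module.finrank ℝ E = 3) {k₁ : M → Circle} {k₂ : M → ℂ}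
    {k₃ : M → ℝ} {p : M} {c : ℝ} (h₁ : ContMDiffAt I (𝓡 1) ∞ k₁ p)
    (h₂ : ContMDiffAt I 𝓘(ℝ, ℂ) ∞ k₂ p) (h₃ : ContMDiffAt I 𝓘(ℝ, ℝ) ∞ k₃ p)
    (hx : k₂ p ≠ 0 ∨ k₃ p ≠ 0) (hc : ∀ᶠ m in 𝓝 p, k₃ m ^ 2 - ‖k₂ m‖ ^ 2 = c) {ι : M → E'}
    {h : C3 × ℂ × ℂ × ℝ → E'}
    (hh : DifferentiableAt ℝ h (F.sweep (k₁ p) (k₂ p) (k₃ p), k₁ p, k₂ p, k₃ p))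
    (hι : ι =ᶠ[𝓝 p] fun m => h (F.sweep (k₁ m) (k₂ m) (k₃ m), k₁ m, k₂ m, k₃ m))
    (hinj : Function.Injective (mfderiv I 𝓘(ℝ, E') ι p)) :
    IsSLImmersionAt I (fun m => F.sweep (k₁ m) (k₂ m) (k₃ m)) p := by
  obtain ⟨l, hl, hl'⟩ := exists_smooth_arg (k₁ p)
  let g : M → ℝ × (Fin 3 → ℝ) := fun m => F.coord (l (k₁ m)) (k₂ m) (k₃ m)
  have hs : ∀ m, F.sweep (k₁ m) (k₂ m) (k₃ m) = F.point (g m).1 (g m).2 := fun m =>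
    F.sweep_eq (hl' _) _ _
  have hg : ContMDiffAt I 𝓘(ℝ, ℝ × (Fin 3 → ℝ)) ∞ g p :=
    ContMDiffAt.comp p (F.contDiff_coord.contMDiff (l (k₁ p), k₂ p, k₃ p))
      ((ContMDiffAt.comp p hl h₁).prodMk_space (h₂.prodMk_space h₃))
  -- the inverse of the coordinates, in the form of a smooth map on `ℝ × ℝ³`
  let r : ℝ × (Fin 3 → ℝ) → C3 × ℂ × ℂ × ℝ := fun y => (F.point y.1 y.2,
    Complex.exp ((y.1 / F.κ : ℝ) * Complex.I),
    Complex.exp (-(Complex.I * (F.a 1 * (y.1 / F.κ / 2) : ℝ))) * (y.2 1 + y.2 2 * Complex.I),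
    y.2 0)
  have hr : Differentiable ℝ r := by
    have ho : ∀ f : ℝ × (Fin 3 → ℝ) → ℝ, Differentiable ℝ f →
        Differentiable ℝ fun y => ((f y : ℝ) : ℂ) := fun f hf =>
      Complex.ofRealCLM.differentiable.comp hf
    refine (F.contDiff_point.differentiable (by simp)).prodMk (Differentiable.prodMk ?_
      (Differentiable.prodMk ?_ (by fun_prop)))
    · exact ((ho _ (by fun_prop)).mul_const _).cexp
    · exact ((ho _ (by fun_prop)).const_mul _).neg.cexp.mul
        ((ho _ (by fun_prop)).add ((ho _ (by fun_prop)).mul_const _))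
  have hrg : ∀ m, r (g m) = (F.sweep (k₁ m) (k₂ m) (k₃ m), (k₁ m : ℂ), k₂ m, k₃ m) := fun m => by
    have hκ := F.κ_pos.ne'
    have h1 : F.κ * l (k₁ m) / F.κ = l (k₁ m) := by field_simp
    simp only [r, hs m]
    refine Prod.ext rfl (Prod.ext ?_ (Prod.ext ?_ rfl))
    · conv_rhs => rw [← hl' (k₁ m), Circle.coe_exp]
      simp only [g, coord, h1]
    · simp only [g, coord, h1, Matrix.cons_val_one, Matrix.cons_val_zero, Matrix.cons_val]
      rw [Complex.re_add_im, ← mul_assoc, twist, ← Complex.exp_add, neg_add_cancel,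
        Complex.exp_zero, one_mul]
  refine F.isSLImmersionAt hE (c := c) hg (Filter.Eventually.of_forall hs) ?_ ?_ ?_
  · intro h0
    have h1 := F.norm_twist (l (k₁ p))
    rcases hx with hx | hx
    · have h2 : F.twist (l (k₁ p)) * k₂ p = 0 :=
        Complex.ext (congrFun h0 1) (congrFun h0 2)
      refine (mul_eq_zero.1 h2).elim (fun h3 => ?_) hx
      rw [h3, norm_zero] at h1
      exact zero_ne_one h1
    · exact hx (congrFun h0 0)
  · filter_upwards [hc] with m hm
    rw [← hm]
    exact F.sum_sgn_coord _ _ _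
  · have hgd := (hg.mdifferentiableAt (by simp)).hasMFDerivAt
    have hd : DifferentiableAt ℝ (h ∘ r) (g p) := by
      refine DifferentiableAt.comp (g p) ?_ (hr _)
      rwa [hrg p]
    have hcomp := (hd.hasFDerivAt.hasMFDerivAt.comp p hgd).congr_of_eventuallyEq
      (f₁ := ι) (hι.trans (Filter.Eventually.of_forall fun m => by
        simp only [Function.comp_apply, hrg m]))
    rw [hcomp.mfderiv] at hinj
    exact Function.Injective.of_comp hinj

end EvenPeriodicSolution

/-- A special Lagrangian immersion meets the coordinate hyperplanes in nowhere dense sets. -/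
lemma IsSLImmersionAt.not_eventually_apply_eq_zero {Φ : M → C3} {p : M}
    (hΦ : IsSLImmersionAt I Φ p) (j : Fin 3) : ¬ ∀ᶠ m in 𝓝 p, Φ m j = 0 := by
  intro h3
  obtain ⟨v, ⟨y, rfl⟩, hv⟩ := hΦ.plane.exists_apply_ne_zero j
  have h1 := (hΦ.smooth.mdifferentiableAt (by simp)).hasMFDerivAt
  have h2 := (PiLp.hasFDerivAt_apply (𝕜 := ℝ) 2 (Φ p) j).hasMFDerivAt.comp p h1
  have h4 := (hasMFDerivAt_const (0 : ℂ) p (I := I) (I' := 𝓘(ℝ, ℂ))).congr_of_eventuallyEq h3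
  have h5 := hasMFDerivAt_unique h2 h4
  exact hv (congrArg (fun L : E →L[ℝ] ℂ => L y) h5)

end

lemma isOpen_apply_ne_zero {X : Type*} [TopologicalSpace X] {Φ : X → C3} (h : Continuous Φ)
    (j : Fin 3) : IsOpen {p | Φ p j ≠ 0} := by
  have h1 : Continuous fun p => Φ p j := (PiLp.continuous_apply 2 _ j).comp h
  exact isOpen_ne_fun h1 continuous_const

lemma isOpen_forall_apply_ne_zero {X : Type*} [TopologicalSpace X] {Φ : X → C3}
    (h : Continuous Φ) : IsOpen {p | ∀ j, Φ p j ≠ 0} := by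
  rw [Set.ofPred_forall]
  exact isOpen_iInter_of_finite fun j => isOpen_apply_ne_zero h j

lemma dense_forall_apply_ne_zero {X : Type*} [TopologicalSpace X] {Φ : X → C3}
    (hc : Continuous Φ) (hΦ : ∀ p j, ¬ ∀ᶠ m in 𝓝 p, Φ m j = 0) :
    Dense {p | ∀ j, Φ p j ≠ 0} := by
  have h : ∀ j, Dense {p | Φ p j ≠ 0} := fun j => by
    rw [show {p | Φ p j ≠ 0} = {p | Φ p j = 0}ᶜ from rfl, ← interior_eq_empty_iff_dense_compl]
    by_contra hne
    obtain ⟨p, hp⟩ := Set.nonempty_iff_ne_empty.2 hne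
    exact hΦ p j (mem_interior_iff_mem_nhds.1 hp)
  have h1 := ((h 0).inter_of_isOpen_left (h 1) (isOpen_apply_ne_zero hc 0)).inter_of_isOpen_right
    (h 2) (isOpen_apply_ne_zero hc 2)
  refine h1.mono fun p hp j => ?_
  fin_cases j
  exacts [hp.1.1, hp.1.2, hp.2]

/-! ### The three topological types -/

section

variable {E : Type*} [NormedAddCommGroup E] [NormedSpace ℝ E]
  {H : Type*} [TopologicalSpace H] {I : ModelWithCorners ℝ E H}
  {M : Type*} [TopologicalSpace M] [ChartedSpace H M]

lemma IsClosedImmersedSL.neg {S : Set C3} (h : IsClosedImmersedSL I M S) :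
    IsClosedImmersedSL I M (-S) := by
  obtain ⟨hS, Φ, h1, h2, ⟨W, hW, hW', h3⟩, rfl⟩ := h
  refine ⟨hS.neg, fun p => -Φ p, fun p => (h1 p).neg,
    (Homeomorph.neg C3).isProperMap.comp h2, ⟨W, hW, hW', fun p hp q hq =>
      h3 p hp q (neg_injective hq)⟩, ?_⟩
  ext z
  simp [neg_eq_iff_eq_neg]

lemma IsImmersedPoint.neg {S : Set C3} (h : IsImmersedPoint (-S) 0) : IsImmersedPoint S 0 := by
  obtain ⟨f, h1, h2, h3, h4⟩ := h
  refine ⟨fun x => -f x, h1.neg, ?_, by simp [h3], ?_⟩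
  · rw [show (fun x => -f x) = -f from rfl, fderiv_neg]
    exact fun v w hvw => h2 (neg_injective hvw)
  · filter_upwards [h4] with x hx using hx

lemma IsClosedImmersedSLConeOnTorus.neg {S : Set C3} (h : IsClosedImmersedSLConeOnTorus S) :
    IsClosedImmersedSLConeOnTorus (-S) := by
  obtain ⟨hS, ⟨Ψ, h1, ⟨W, hW, hW', h2⟩, h3, h4⟩, h5⟩ := h
  refine ⟨hS.neg, ⟨fun p => -Ψ p, by simpa using h1, ⟨W, hW, hW', fun p hp q hq =>
    h2 p hp q (neg_injective hq)⟩, fun p r hr => ?_, ?_⟩, fun h => h5 h.neg⟩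
  · simpa only [smul_neg] using (h3 p r hr).neg
  · rw [h4]
    ext z
    simp [neg_eq_iff_eq_neg]

lemma mfderiv_prodMap_injective {E' H' M' E₁ E₂ : Type*} [NormedAddCommGroup E']
    [NormedSpace ℝ E'] [TopologicalSpace H'] {J : ModelWithCorners ℝ E' H'}
    [TopologicalSpace M'] [ChartedSpace H' M'] [NormedAddCommGroup E₁] [NormedSpace ℝ E₁]
    [NormedAddCommGroup E₂] [NormedSpace ℝ E₂] {f : M → E₁} {g : M' → E₂} {p : M × M'}
    (hf : MDifferentiableAt I 𝓘(ℝ, E₁) f p.1) (hg : MDifferentiableAt J 𝓘(ℝ, E₂) g p.2)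
    (hf' : Function.Injective (mfderiv I 𝓘(ℝ, E₁) f p.1))
    (hg' : Function.Injective (mfderiv J 𝓘(ℝ, E₂) g p.2)) :
    Function.Injective (mfderiv (I.prod J) 𝓘(ℝ, E₁ × E₂) (Prod.map f g) p) := by
  rw [modelWithCornersSelf_prod, ← chartedSpaceSelf_prod, mfderiv_prodMap hf hg]
  exact hf'.prodMap hg'

/-- A special Lagrangian immersion with compact sublevel sets of the norm is proper, and for generic
injectivity it suffices to look at the points with all three coordinates nonzero. -/
lemma isClosedImmersedSL_range {Φ : M → C3} (h1 : ∀ p, IsSLImmersionAt I Φ p)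
    (h2 : ∀ R : ℝ, ∃ K, IsCompact K ∧ ∀ p, ‖Φ p‖ ≤ R → p ∈ K)
    (h3 : ∀ p, (∀ j, Φ p j ≠ 0) → ∀ q, Φ q = Φ p → q = p) :
    IsClosedImmersedSL I M (Set.range Φ) := by
  have hc : Continuous Φ := continuous_iff_continuousAt.2 fun p => (h1 p).smooth.continuousAt
  have hp : IsProperMap Φ := by
    refine isProperMap_iff_isCompact_preimage.2 ⟨hc, fun K hK => ?_⟩
    obtain ⟨R, hR⟩ := hK.isBounded.exists_norm_le
    obtain ⟨K', hK', h⟩ := h2 R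
    exact hK'.of_isClosed_subset (hK.isClosed.preimage hc) fun p hp => h p (hR _ hp)
  exact ⟨hp.isClosed_range, Φ, h1, hp, ⟨_, isOpen_forall_apply_ne_zero hc,
    dense_forall_apply_ne_zero hc fun p j => (h1 p).not_eventually_apply_eq_zero j, h3⟩, rfl⟩

end

namespace Solution

variable (D : Solution) (c : ℝ)

lemma N_eq_union : D.N c = D.Npos c ∪ D.Nneg c := by
  ext z
  constructor
  · rintro ⟨t, x, hx, rfl⟩
    rcases le_total 0 (x 0) with h | h
    · exact Or.inl ⟨t, x, hx, h, rfl⟩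
    · exact Or.inr ⟨t, x, hx, h, rfl⟩
  · rintro (⟨t, x, hx, -, rfl⟩ | ⟨t, x, hx, -, rfl⟩) <;> exact ⟨t, x, hx, rfl⟩

lemma Nneg_eq_neg : D.Nneg c = -D.Npos c := by
  ext z
  constructor
  · rintro ⟨t, x, hx, h0, rfl⟩
    exact ⟨t, -x, by simpa using hx, by simpa using h0, by rw [point_neg]⟩
  · rintro ⟨t, x, hx, h0, hz⟩
    exact ⟨t, -x, by simpa using hx, by simpa using h0, by rw [point_neg, ← hz, neg_neg]⟩

lemma N_eq_neg : D.N c = -D.N c := by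
  rw [N_eq_union, Nneg_eq_neg, Set.union_neg, neg_neg, Set.union_comm]

end Solution

namespace EvenPeriodicSolution

variable (F : EvenPeriodicSolution)

lemma mem_N_iff {c : ℝ} {z : C3} :
    z ∈ F.N c ↔ ∃ q ζ ξ, ξ ^ 2 - ‖ζ‖ ^ 2 = c ∧ z = F.sweep q ζ ξ := by
  constructor
  · rintro ⟨t, x, hx, rfl⟩
    obtain ⟨q, ζ, h, h'⟩ := F.exists_sweep_eq t x
    exact ⟨q, ζ, x 0, h'.trans hx, h⟩
  · rintro ⟨q, ζ, ξ, h, rfl⟩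
    exact ⟨_, _, (F.sum_sgn_coord _ _ _).trans h, rfl⟩

lemma mem_Npos_iff {c : ℝ} {z : C3} :
    z ∈ F.Npos c ↔ ∃ q ζ ξ, ξ ^ 2 - ‖ζ‖ ^ 2 = c ∧ 0 ≤ ξ ∧ z = F.sweep q ζ ξ := by
  constructor
  · rintro ⟨t, x, hx, h0, rfl⟩
    obtain ⟨q, ζ, h, h'⟩ := F.exists_sweep_eq t x
    exact ⟨q, ζ, x 0, h'.trans hx, h0, h⟩
  · rintro ⟨q, ζ, ξ, h, h0, rfl⟩
    exact ⟨_, _, (F.sum_sgn_coord _ _ _).trans h, h0, rfl⟩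

/-- The sign of `x₁` is determined by a generic point of `N`, since `a₁` is even. -/
lemma Npos_ne_Nneg {c : ℝ} (hc : 0 ≤ c) : F.Npos c ≠ F.Nneg c := by
  intro h
  set x : Fin 3 → ℝ := ![√(c + 2), 1, 1] with hx
  have h0 : 0 < √(c + 2) := Real.sqrt_pos.2 (by linarith)
  have hxc : ∑ j, sgn j * x j ^ 2 = c := by
    simp only [Fin.sum_univ_three, hx, sgn_zero, sgn_one, sgn_two, Matrix.cons_val_zero,
      Matrix.cons_val_one, Matrix.cons_val, Real.sq_sqrt (show 0 ≤ c + 2 by linarith)]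
    ring
  have hmem : F.point 0 x ∈ F.Nneg c := h ▸ ⟨0, x, hxc, h0.le, rfl⟩
  obtain ⟨t', x', hx', hneg, heq⟩ := hmem
  obtain ⟨m, hm⟩ := F.exists_int_of_point_eq heq
    (fun j => by fin_cases j <;> simp [hx, h0.ne']) (hxc.trans hx'.symm)
  have h1 := congrFun (congrArg WithLp.ofLp heq) 0
  rw [Solution.point_apply_eq_mul_w, Solution.point_apply_eq_mul_w, hm, w_add,
    neg_one_zpow_mul_a_zero, Complex.ofReal_one, one_mul] at h1
  have h2 : x 0 = x' 0 := by exact_mod_cast mul_right_cancel₀ (F.w_ne_zero 0 _) h1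
  rw [← h2] at hneg
  exact absurd hneg (not_le.2 h0)

lemma ρ_periodic (j : Fin 3) : Function.Periodic (F.ρ j) F.T := fun t => by
  rw [Solution.ρ, F.u_periodic, Solution.ρ]

lemma exists_le_ρ : ∃ δ : ℝ, 0 < δ ∧ ∀ j t, δ ≤ F.ρ j t := by
  have h : ∀ j, ∃ δ : ℝ, 0 < δ ∧ ∀ t, δ ≤ F.ρ j t := fun j => by
    obtain ⟨_, ⟨s, rfl⟩, hs⟩ := ((F.ρ_periodic j).compact_of_continuous F.T_pos.ne'
      (F.contDiff_ρ j).continuous).exists_isLeast (Set.range_nonempty _)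
    exact ⟨_, F.ρ_pos j s, fun t => hs ⟨t, rfl⟩⟩
  choose δ h0 h1 using h
  refine ⟨min (δ 0) (min (δ 1) (δ 2)), lt_min (h0 0) (lt_min (h0 1) (h0 2)), fun j t => ?_⟩
  refine le_trans ?_ (h1 j t)
  fin_cases j <;> simp

/-- The evolving quadric stays away from zero, uniformly in time. -/
lemma exists_le_norm_sweep : ∃ δ : ℝ, 0 < δ ∧
    ∀ q ζ ξ, δ * (ξ ^ 2 + ‖ζ‖ ^ 2) ≤ ‖F.sweep q ζ ξ‖ ^ 2 := by
  obtain ⟨δ, h0, h⟩ := F.exists_le_ρ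
  refine ⟨δ, h0, fun q ζ ξ => ?_⟩
  have h1 : ‖F.twist (Complex.arg q) * ζ‖ ^ 2 = ‖ζ‖ ^ 2 := by rw [norm_mul, norm_twist, one_mul]
  rw [← h1, ← Complex.normSq_eq_norm_sq, Complex.normSq_apply, EuclideanSpace.norm_sq_eq,
    Fin.sum_univ_three, sweep]
  simp only [Solution.norm_point_apply_sq]
  have h2 : ∀ j (y : ℝ), δ * y ^ 2 ≤ y ^ 2 * F.ρ j (F.coord (Complex.arg q) ζ ξ).1 := fun j y => by
    rw [mul_comm]; exact mul_le_mul_of_nonneg_left (h j _) (sq_nonneg y)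
  refine le_trans (le_of_eq ?_) (add_le_add (add_le_add (h2 0 _) (h2 1 _)) (h2 2 _))
  simp [coord]
  ring

lemma sweep_ne_zero {q : Circle} {ζ : ℂ} {ξ : ℝ} (hξ : ξ ≠ 0) : F.sweep q ζ ξ ≠ 0 := by
  obtain ⟨δ, h0, h⟩ := F.exists_le_norm_sweep
  intro hz
  have h1 := h q ζ ξ
  rw [hz, norm_zero] at h1
  have : 0 < ξ ^ 2 := by positivity
  nlinarith [sq_nonneg ‖ζ‖]

lemma smul_sweep (r : ℝ) (q : Circle) (ζ : ℂ) (ξ : ℝ) :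
    r • F.sweep q ζ ξ = F.sweep q (r * ζ) (r * ξ) := by
  ext j
  simp only [sweep, PiLp.smul_apply, Solution.point_apply_eq_mul_w, Complex.real_smul, ← mul_assoc,
    ← Complex.ofReal_mul]
  congr 2
  fin_cases j
  · simp [coord]
  · simp [coord, mul_left_comm, -Complex.mul_re, Complex.re_ofReal_mul]
  · simp [coord, mul_left_comm, -Complex.mul_im, Complex.im_ofReal_mul]

/-- For `c > 0` the sheet `x₁ ≥ 0` of the quadric is a plane. -/
lemma isClosedImmersedSL_Npos {c : ℝ} (hc : 0 < c) :
    IsClosedImmersedSL ((𝓡 1).prod (𝓡 2)) (Circle × EuclideanSpace ℝ (Fin 2)) (F.Npos c) := by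
  let L : EuclideanSpace ℝ (Fin 2) ≃ₗᵢ[ℝ] ℂ := Complex.orthonormalBasisOneI.repr.symm
  have hpos : ∀ y : EuclideanSpace ℝ (Fin 2), 0 < c + ‖y‖ ^ 2 := fun y => by positivity
  let Φ : Circle × EuclideanSpace ℝ (Fin 2) → C3 := fun m => F.sweep m.1 (L m.2) √(c + ‖m.2‖ ^ 2)
  have hq : ∀ y : EuclideanSpace ℝ (Fin 2), √(c + ‖y‖ ^ 2) ^ 2 - ‖L y‖ ^ 2 = c := fun y => by
    rw [Real.sq_sqrt (hpos y).le, L.norm_map]; ring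
  have hrange : F.Npos c = Set.range Φ := by
    ext z
    rw [mem_Npos_iff]
    constructor
    · rintro ⟨q, ζ, ξ, h, h0, rfl⟩
      refine ⟨(q, L.symm ζ), ?_⟩
      simp only [Φ, L.apply_symm_apply, L.symm.norm_map]
      rw [← h, sub_add_cancel, Real.sqrt_sq h0]
    · rintro ⟨m, rfl⟩
      exact ⟨_, _, _, hq m.2, Real.sqrt_nonneg _, rfl⟩
  rw [hrange]
  refine isClosedImmersedSL_range (fun p => ?_) (fun R => ?_) fun p hp q hpq => ?_
  · have hL : Function.Injective (fderiv ℝ L p.2) := by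
      rw [show fderiv ℝ L p.2 = (L.toContinuousLinearEquiv : _ →L[ℝ] ℂ) from
        L.toContinuousLinearEquiv.fderiv]
      exact L.injective
    have hinj := mfderiv_prodMap_injective (f := fun q : Circle => (q : ℂ)) (g := L)
      ((contMDiff_circle_coe p.1).mdifferentiableAt (by simp))
      L.differentiable.differentiableAt.mdifferentiableAt (mfderiv_circle_coe_injective p.1)
      (by rw [mfderiv_eq_fderiv]; exact hL)
    refine F.isSLImmersionAt_sweep (by simp) (c := c) (E' := ℂ × ℂ)
      (ι := Prod.map (fun q : Circle => (q : ℂ)) L) (h := fun y => (y.2.1, y.2.2.1))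
      contMDiffAt_fst ?_ ?_ (Or.inr (Real.sqrt_pos.2 (hpos _)).ne')
      (Filter.Eventually.of_forall fun m => hq m.2) (by fun_prop)
      (Filter.Eventually.of_forall fun m => rfl) hinj
    · exact L.toContinuousLinearEquiv.contDiff.contMDiff.contMDiffAt.comp p contMDiffAt_snd
    · have h : ContDiff ℝ ∞ fun y : EuclideanSpace ℝ (Fin 2) => √(c + ‖y‖ ^ 2) :=
        (contDiff_const.add (contDiff_norm_sq ℝ)).sqrt fun y => (hpos y).ne'
      exact h.contMDiff.contMDiffAt.comp p contMDiffAt_snd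
  · obtain ⟨δ, h0, h⟩ := F.exists_le_norm_sweep
    refine ⟨Set.univ ×ˢ Metric.closedBall 0 √(R ^ 2 / δ),
      isCompact_univ.prod (isCompact_closedBall _ _), fun p hp => ⟨trivial, ?_⟩⟩
    have h1 := h p.1 (L p.2) √(c + ‖p.2‖ ^ 2)
    have h2 : ‖Φ p‖ ^ 2 ≤ R ^ 2 := pow_le_pow_left₀ (norm_nonneg _) hp 2
    rw [mem_closedBall_zero_iff]
    refine Real.le_sqrt_of_sq_le ((le_div_iff₀ h0).2 ?_)
    rw [L.norm_map] at h1
    change _ ≤ ‖Φ p‖ ^ 2 at h1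
    nlinarith [sq_nonneg √(c + ‖p.2‖ ^ 2)]
  · obtain ⟨h1, h2, -⟩ := F.sweep_inj hpq hp ((hq _).trans (hq _).symm)
    exact Prod.ext h1 (L.injective h2)

end EvenPeriodicSolution

/-- The product of two circles and a line is immersed in `(ℂ × ℂ) × ℝ`. -/
lemma mfderiv_torus_prod_injective (p : (Circle × Circle) × ℝ) : Function.Injective
    (mfderiv (((𝓡 1).prod (𝓡 1)).prod 𝓘(ℝ, ℝ)) 𝓘(ℝ, (ℂ × ℂ) × ℝ)
      (Prod.map (Prod.map (fun q : Circle => (q : ℂ)) fun q : Circle => (q : ℂ)) id) p) := by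
  have hd : ∀ q, MDifferentiableAt (𝓡 1) 𝓘(ℝ, ℂ) (fun q : Circle => (q : ℂ)) q := fun q =>
    (contMDiff_circle_coe q).mdifferentiableAt (by simp)
  refine mfderiv_prodMap_injective ?_ mdifferentiableAt_id
    (mfderiv_prodMap_injective (hd _) (hd _) (mfderiv_circle_coe_injective _)
      (mfderiv_circle_coe_injective _)) ?_
  · rw [modelWithCornersSelf_prod, ← chartedSpaceSelf_prod]
    exact (hd _).prodMap (hd _)
  · rw [mfderiv_id]
    exact Function.injective_id

lemma contMDiffAt_complex_mul {E H M : Type*} [NormedAddCommGroup E] [NormedSpace ℝ E]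
    [TopologicalSpace H] {I : ModelWithCorners ℝ E H} [TopologicalSpace M] [ChartedSpace H M]
    {f g : M → ℂ} {p : M} (hf : ContMDiffAt I 𝓘(ℝ, ℂ) ∞ f p) (hg : ContMDiffAt I 𝓘(ℝ, ℂ) ∞ g p) :
    ContMDiffAt I 𝓘(ℝ, ℂ) ∞ (fun m => f m * g m) p :=
  ContMDiffAt.comp p (contDiff_mul (𝕜 := ℝ) (𝔸 := ℂ)).contMDiff.contMDiffAt (hf.prodMk_space hg)

namespace EvenPeriodicSolution

variable (F : EvenPeriodicSolution)

/-- For `c < 0` the quadric is a cylinder. -/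
lemma isClosedImmersedSL_N {c : ℝ} (hc : c < 0) :
    IsClosedImmersedSL (((𝓡 1).prod (𝓡 1)).prod 𝓘(ℝ, ℝ)) ((Circle × Circle) × ℝ) (F.N c) := by
  have hpos : ∀ ξ : ℝ, 0 < ξ ^ 2 - c := fun ξ => by nlinarith [sq_nonneg ξ]
  have hs : ∀ ξ : ℝ, √(ξ ^ 2 - c) ≠ 0 := fun ξ => (Real.sqrt_pos.2 (hpos ξ)).ne'
  have hnorm : ∀ (p : Circle) (ξ : ℝ), ‖((√(ξ ^ 2 - c) : ℝ) : ℂ) * p‖ = √(ξ ^ 2 - c) := by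
    intro p ξ
    rw [norm_mul, Circle.norm_coe, mul_one, Complex.norm_real, Real.norm_eq_abs,
      abs_of_nonneg (Real.sqrt_nonneg _)]
  have hq : ∀ (p : Circle) (ξ : ℝ), ξ ^ 2 - ‖((√(ξ ^ 2 - c) : ℝ) : ℂ) * p‖ ^ 2 = c := fun p ξ => by
    rw [hnorm, Real.sq_sqrt (hpos ξ).le]; ring
  let Φ : (Circle × Circle) × ℝ → C3 := fun m =>
    F.sweep m.1.1 (((√(m.2 ^ 2 - c) : ℝ) : ℂ) * m.1.2) m.2
  have hrange : F.N c = Set.range Φ := by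
    ext z
    rw [mem_N_iff]
    constructor
    · rintro ⟨q, ζ, ξ, h, rfl⟩
      have hζ : √(ξ ^ 2 - c) = ‖ζ‖ := by
        rw [← h, sub_sub_cancel, Real.sqrt_sq (norm_nonneg _)]
      refine ⟨((q, Circle.exp (Complex.arg ζ)), ξ), ?_⟩
      simp only [Φ, hζ, Circle.coe_exp, Complex.norm_mul_exp_arg_mul_I]
    · rintro ⟨m, rfl⟩
      exact ⟨_, _, _, hq m.1.2 m.2, rfl⟩
  have hsm : ContDiff ℝ ∞ fun ξ : ℝ => ((√(ξ ^ 2 - c) : ℝ) : ℂ) :=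
    Complex.ofRealCLM.contDiff.comp
      (((contDiff_id.pow 2).sub contDiff_const).sqrt fun ξ => (hpos ξ).ne')
  rw [hrange]
  refine isClosedImmersedSL_range (fun p => ?_) (fun R => ?_) fun p hp q hpq => ?_
  · refine F.isSLImmersionAt_sweep (by simp) (c := c) (E' := (ℂ × ℂ) × ℝ)
      (h := fun y => ((y.2.1, y.2.2.1 / ((√(y.2.2.2 ^ 2 - c) : ℝ) : ℂ)), y.2.2.2))
      (contMDiffAt_fst.comp p contMDiffAt_fst) ?_ contMDiffAt_snd (Or.inl ?_)
      (Filter.Eventually.of_forall fun m => hq m.1.2 m.2) ?_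
      (Filter.Eventually.of_forall fun m => ?_) (mfderiv_torus_prod_injective p)
    · exact contMDiffAt_complex_mul (hsm.contMDiff.contMDiffAt.comp p contMDiffAt_snd)
        ((contMDiff_circle_coe _).comp p (contMDiffAt_snd.comp p contMDiffAt_fst))
    · exact mul_ne_zero (Complex.ofReal_ne_zero.2 (hs _)) p.1.2.coe_ne_zero
    · have h1 : Differentiable ℝ fun y : C3 × ℂ × ℂ × ℝ => ((√(y.2.2.2 ^ 2 - c) : ℝ) : ℂ) :=
        (hsm.differentiable (by simp)).comp
          (differentiable_snd.comp (differentiable_snd.comp differentiable_snd))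
      have h2 : Differentiable ℝ fun y : C3 × ℂ × ℂ × ℝ =>
          y.2.2.1 / ((√(y.2.2.2 ^ 2 - c) : ℝ) : ℂ) := by
        simp only [div_eq_mul_inv]
        exact (differentiable_fst.comp (differentiable_snd.comp differentiable_snd)).fun_mul
          (h1.inv fun y => Complex.ofReal_ne_zero.2 (hs y.2.2.2))
      fun_prop
    · simp only [Prod.map, id]
      rw [mul_div_cancel_left₀ _ (Complex.ofReal_ne_zero.2 (hs _))]
  · obtain ⟨δ, h0, h⟩ := F.exists_le_norm_sweep
    refine ⟨Set.univ ×ˢ Metric.closedBall 0 √(R ^ 2 / δ),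
      isCompact_univ.prod (isCompact_closedBall _ _), fun p hp => ⟨trivial, ?_⟩⟩
    have h1 := h p.1.1 (((√(p.2 ^ 2 - c) : ℝ) : ℂ) * p.1.2) p.2
    have h2 : ‖Φ p‖ ^ 2 ≤ R ^ 2 := pow_le_pow_left₀ (norm_nonneg _) hp 2
    rw [mem_closedBall_zero_iff]
    refine Real.le_sqrt_of_sq_le ((le_div_iff₀ h0).2 ?_)
    rw [hnorm] at h1
    change _ ≤ ‖Φ p‖ ^ 2 at h1
    rw [Real.norm_eq_abs, sq_abs]
    nlinarith [sq_nonneg √(p.2 ^ 2 - c)]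
  · obtain ⟨h1, h2, h3⟩ := F.sweep_inj hpq hp ((hq _ _).trans (hq _ _).symm)
    rw [h3] at h2
    have h4 := mul_left_cancel₀ (Complex.ofReal_ne_zero.2 (hs _)) h2
    exact Prod.ext (Prod.ext h1 (Circle.ext h4)) h3

/-- The cone lies in `‖z‖ ≤ K |z₁|`, and so would the tangent space of an immersed disc through the
vertex. But `z₁`, being complex-valued, is not injective on a real 3-space. -/
lemma not_isImmersedPoint_Npos_zero : ¬ IsImmersedPoint (F.Npos 0) 0 := by
  rintro ⟨f, h1, h2, h3, h4⟩
  -- the cone is contained in a closed cone `‖z‖ ≤ K |z₁|`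
  obtain ⟨δ, hδ, hρ⟩ := F.exists_le_ρ
  obtain ⟨R, hR⟩ := F.exists_bound
  set K : ℝ := (F.α 0 + F.α 1 + F.α 2 + R) / δ with hK
  have hcone : ∀ z ∈ F.Npos 0, ‖z‖ ^ 2 ≤ K * ‖z 0‖ ^ 2 := by
    rintro _ ⟨t, x, hx, -, rfl⟩
    rw [EuclideanSpace.norm_sq_eq, Fin.sum_univ_three]
    simp only [Solution.norm_point_apply_sq]
    simp only [Fin.sum_univ_three, sgn_zero, sgn_one, sgn_two] at hx
    have e1 : x 1 ^ 2 ≤ x 0 ^ 2 := by nlinarith [sq_nonneg (x 2)]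
    have e2 : x 2 ^ 2 ≤ x 0 ^ 2 := by nlinarith [sq_nonneg (x 1)]
    have hsum : F.ρ 0 t + F.ρ 1 t + F.ρ 2 t ≤ K * δ := by
      rw [hK, div_mul_cancel₀ _ hδ.ne']
      have := neg_abs_le (F.u t)
      have := (hR t).1
      simp only [Solution.ρ, sgn_zero, sgn_one, sgn_two]
      linarith
    have hK0 : 0 ≤ K := by
      have h5 := F.ρ_pos 0 t
      have h6 := F.ρ_pos 1 t
      have h7 := F.ρ_pos 2 t
      by_contra! hneg
      nlinarith
    calc x 0 ^ 2 * F.ρ 0 t + x 1 ^ 2 * F.ρ 1 t + x 2 ^ 2 * F.ρ 2 t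
        ≤ x 0 ^ 2 * F.ρ 0 t + x 0 ^ 2 * F.ρ 1 t + x 0 ^ 2 * F.ρ 2 t :=
          add_le_add (add_le_add le_rfl (mul_le_mul_of_nonneg_right e1 (F.ρ_pos 1 t).le))
            (mul_le_mul_of_nonneg_right e2 (F.ρ_pos 2 t).le)
      _ = x 0 ^ 2 * (F.ρ 0 t + F.ρ 1 t + F.ρ 2 t) := by ring
      _ ≤ x 0 ^ 2 * (K * F.ρ 0 t) := mul_le_mul_of_nonneg_left
          (hsum.trans (mul_le_mul_of_nonneg_left (hρ 0 t) hK0)) (sq_nonneg _)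
      _ = K * (x 0 ^ 2 * F.ρ 0 t) := by ring
  set L := fderiv ℝ f 0
  -- hence so is the tangent space of the disc
  have hL : ∀ v, ‖L v‖ ^ 2 ≤ K * ‖L v 0‖ ^ 2 := by
    intro v
    have hd : HasDerivAt (fun s : ℝ => f (s • v)) (L v) 0 := by
      have h5 : HasFDerivAt f L ((0 : ℝ) • v) := by
        rw [zero_smul]
        exact (h1.differentiableAt (by simp)).hasFDerivAt
      have h6 : HasDerivAt (fun s : ℝ => s • v) v 0 := by
        simpa using (hasDerivAt_id (0 : ℝ)).smul_const v
      exact h5.comp_hasDerivAt (0 : ℝ) h6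
    have hlim := hasDerivAt_iff_tendsto_slope_zero.1 hd
    simp only [zero_add, zero_smul, h3, sub_zero] at hlim
    have hev : ∀ᶠ s : ℝ in 𝓝[≠] 0, ‖s⁻¹ • f (s • v)‖ ^ 2 ≤ K * ‖(s⁻¹ • f (s • v)) 0‖ ^ 2 := by
      have h5 : Filter.Tendsto (fun s : ℝ => s • v) (𝓝[≠] 0) (𝓝 0) := by
        have : Continuous fun s : ℝ => s • v := by fun_prop
        simpa using (this.tendsto 0).mono_left nhdsWithin_le_nhds
      filter_upwards [h5.eventually h4] with s hs
      have h6 := hcone _ hs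
      rw [PiLp.smul_apply, norm_smul, norm_smul, mul_pow, mul_pow]
      nlinarith [mul_le_mul_of_nonneg_left h6 (sq_nonneg ‖s⁻¹‖)]
    refine le_of_tendsto_of_tendsto (hlim.norm.pow 2) (Filter.Tendsto.const_mul K
      (Filter.Tendsto.pow (Filter.Tendsto.norm ?_) 2)) hev
    exact ((PiLp.continuous_apply 2 (fun _ : Fin 3 => ℂ) 0).tendsto _).comp hlim
  let P : EuclideanSpace ℝ (Fin 3) →ₗ[ℝ] ℂ :=
    ((PiLp.proj (𝕜 := ℝ) 2 (fun _ : Fin 3 => ℂ) 0).comp L).toLinearMap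
  have hP : Function.Injective P := by
    rw [injective_iff_map_eq_zero]
    intro v hv
    have h5 := hL v
    have h6 : L v 0 = 0 := hv
    rw [h6, norm_zero] at h5
    have h7 : ‖L v‖ = 0 := by nlinarith [norm_nonneg (L v)]
    exact h2 ((norm_eq_zero.1 h7).trans (map_zero L).symm)
  have := LinearMap.finrank_le_finrank_of_injective hP
  rw [Complex.finrank_real_complex, finrank_euclideanSpace_fin] at this
  omega

/-- For `c = 0` each half of the quadric is a cone on a circle. -/
lemma isClosedImmersedSLConeOnTorus_Npos : IsClosedImmersedSLConeOnTorus (F.Npos 0) := by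
  let n : Circle × Circle → ℝ := fun p => ‖F.sweep p.1 p.2 1‖
  have hn0 : ∀ p : Circle × Circle, F.sweep p.1 p.2 1 ≠ 0 := fun p => F.sweep_ne_zero one_ne_zero
  have hn : ∀ p, 0 < n p := fun p => norm_pos_iff.2 (hn0 p)
  let Ψ : Circle × Circle → C3 := fun p => (n p)⁻¹ • F.sweep p.1 p.2 1
  have hΨ : ∀ p, ‖Ψ p‖ = 1 := fun p => by
    rw [norm_smul, norm_inv, norm_norm, inv_mul_cancel₀ (hn p).ne']
  have hsmul : ∀ (p : Circle × Circle) (r : ℝ),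
      r • Ψ p = F.sweep p.1 ((r / n p : ℝ) * (p.2 : ℂ)) (r / n p) := fun p r => by
    rw [smul_smul, smul_sweep, div_eq_mul_inv, mul_one]
  have hq : ∀ (p : Circle) (ξ : ℝ), ξ ^ 2 - ‖(ξ : ℂ) * p‖ ^ 2 = 0 := fun p ξ => by
    rw [norm_mul, Circle.norm_coe, mul_one, Complex.norm_real, Real.norm_eq_abs, sq_abs, sub_self]
  have hcoe : ContMDiff ((𝓡 1).prod (𝓡 1)) 𝓘(ℝ, ℂ) ∞ fun p : Circle × Circle => (p.2 : ℂ) :=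
    contMDiff_circle_coe.comp contMDiff_snd
  have hsm : ∀ p : Circle × Circle, ContMDiffAt ((𝓡 1).prod (𝓡 1)) 𝓘(ℝ, C3) ∞
      (fun p : Circle × Circle => F.sweep p.1 p.2 1) p := fun p =>
    F.contMDiffAt_sweep contMDiffAt_fst (hcoe p) contMDiffAt_const
  have hnsm : ∀ p, ContMDiffAt ((𝓡 1).prod (𝓡 1)) 𝓘(ℝ, ℝ) ∞ n p := fun p =>
    ContMDiffAt.comp p (contDiffAt_norm ℝ (hn0 p)).contMDiffAt (hsm p)
  have hSL : ∀ p, ∀ r : ℝ, 0 < r → IsSLImmersionAt (((𝓡 1).prod (𝓡 1)).prod 𝓘(ℝ, ℝ))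
      (fun q : (Circle × Circle) × ℝ => q.2 • Ψ q.1) (p, r) := by
    intro p r hr
    have hdiv : ContMDiffAt (((𝓡 1).prod (𝓡 1)).prod 𝓘(ℝ, ℝ)) 𝓘(ℝ, ℝ) ∞
        (fun q : (Circle × Circle) × ℝ => q.2 / n q.1) (p, r) :=
      contMDiffAt_snd.div₀ (ContMDiffAt.comp (g := n) (p, r) (hnsm p) contMDiffAt_fst) (hn p).ne'
    have hξ : r / n p ≠ 0 := (div_pos hr (hn p)).ne'
    simp only [hsmul]
    refine F.isSLImmersionAt_sweep (by simp) (c := 0) (E' := (ℂ × ℂ) × ℝ)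
      (h := fun y => ((y.2.1, y.2.2.1 / (y.2.2.2 : ℂ)), ‖y.1‖))
      (contMDiffAt_fst.comp (p, r) contMDiffAt_fst) ?_ hdiv (Or.inr hξ)
      (Filter.Eventually.of_forall fun m => hq m.1.2 _) ?_ ?_ (mfderiv_torus_prod_injective (p, r))
    · exact contMDiffAt_complex_mul
        (ContMDiffAt.comp (p, r) Complex.ofRealCLM.contDiff.contMDiff.contMDiffAt hdiv)
        (ContMDiffAt.comp (f := Prod.fst) (g := fun p : Circle × Circle => (p.2 : ℂ)) (p, r)
          (hcoe p) contMDiffAt_fst)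
    · refine DifferentiableAt.prodMk (DifferentiableAt.prodMk (by fun_prop) ?_) ?_
      · have h0 : Differentiable ℝ fun y : C3 × ℂ × ℂ × ℝ => y.2.2.2 := by fun_prop
        have h : Differentiable ℝ fun y : C3 × ℂ × ℂ × ℝ => ((y.2.2.2 : ℝ) : ℂ) :=
          Complex.ofRealCLM.differentiable.comp h0
        have h' : Differentiable ℝ fun y : C3 × ℂ × ℂ × ℝ => y.2.2.1 :=
          differentiable_fst.comp (differentiable_snd.comp differentiable_snd)
        simp only [div_eq_mul_inv]
        exact (h' _).fun_mul ((h _).inv (Complex.ofReal_ne_zero.2 hξ))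
      · exact DifferentiableAt.norm ℝ (by fun_prop) (F.sweep_ne_zero hξ)
    · have hr' : ∀ᶠ m : (Circle × Circle) × ℝ in 𝓝 (p, r), 0 < m.2 :=
        (isOpen_lt continuous_const continuous_snd).mem_nhds hr
      filter_upwards [hr'] with m hm
      have h1 : ((m.2 / n m.1 : ℝ) : ℂ) ≠ 0 :=
        Complex.ofReal_ne_zero.2 (div_pos hm (hn m.1)).ne'
      have h2 : ‖m.2 • Ψ m.1‖ = m.2 := by
        rw [norm_smul, hΨ, mul_one, Real.norm_eq_abs, abs_of_pos hm]
      rw [hsmul] at h2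
      simp only [Prod.map, id]
      rw [mul_div_cancel_left₀ _ h1, h2]
  have hΨc : Continuous Ψ := by
    have h1 : Continuous n := continuous_iff_continuousAt.2 fun p => (hnsm p).continuousAt
    have h2 : Continuous fun p : Circle × Circle => F.sweep p.1 p.2 1 :=
      continuous_iff_continuousAt.2 fun p => (hsm p).continuousAt
    exact (h1.inv₀ fun p => (hn p).ne').smul h2
  have hset : F.Npos 0 = {z | ∃ r : ℝ, 0 ≤ r ∧ ∃ p, z = r • Ψ p} := by
    ext z
    rw [mem_Npos_iff]
    constructor
    · rintro ⟨q, ζ, ξ, h, h0, rfl⟩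
      have hζ : ξ = ‖ζ‖ := by
        rw [sub_eq_zero, sq_eq_sq₀ h0 (norm_nonneg _)] at h
        exact h
      let p : Circle × Circle := (q, Circle.exp (Complex.arg ζ))
      refine ⟨ξ * n p, mul_nonneg h0 (hn p).le, p, ?_⟩
      rw [hsmul, mul_div_cancel_right₀ _ (hn p).ne']
      simp only [p, Circle.coe_exp]
      conv_rhs => rw [hζ, Complex.norm_mul_exp_arg_mul_I, ← hζ]
    · rintro ⟨r, h0, p, rfl⟩
      exact ⟨p.1, _, _, hq p.2 _, div_nonneg h0 (hn p).le, hsmul p r⟩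
  refine ⟨?_, ⟨Ψ, hΨ, ⟨_, isOpen_forall_apply_ne_zero hΨc, ?_, ?_⟩, hSL, hset⟩,
    F.not_isImmersedPoint_Npos_zero⟩
  · have hc : Continuous fun q : (Circle × Circle) × ℝ => q.2 • Ψ q.1 :=
      continuous_snd.smul (hΨc.comp continuous_fst)
    have hp : IsProperMap fun q : (Circle × Circle) × ℝ => q.2 • Ψ q.1 := by
      refine isProperMap_iff_isCompact_preimage.2 ⟨hc, fun K hK => ?_⟩
      obtain ⟨R, hR⟩ := hK.isBounded.exists_norm_le
      refine (isCompact_univ.prod (isCompact_closedBall (0 : ℝ) R)).of_isClosed_subset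
        (hK.isClosed.preimage hc) fun q hq => ⟨trivial, ?_⟩
      have := hR _ hq
      rwa [norm_smul, hΨ, mul_one, ← mem_closedBall_zero_iff] at this
    rw [hset]
    convert hp.isClosedMap {q | 0 ≤ q.2} (isClosed_le continuous_const continuous_snd) using 1
    ext z
    constructor
    · rintro ⟨r, h0, p, rfl⟩
      exact ⟨(p, r), h0, rfl⟩
    · rintro ⟨⟨p, r⟩, h0, rfl⟩
      exact ⟨r, h0, p, rfl⟩
  · refine dense_forall_apply_ne_zero hΨc fun p j h => ?_
    refine (hSL p 1 one_pos).not_eventually_apply_eq_zero j ?_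
    have h1 : Filter.Tendsto Prod.fst (𝓝 ((p, 1) : (Circle × Circle) × ℝ)) (𝓝 p) :=
      continuous_fst.tendsto _
    filter_upwards [h1.eventually h] with m hm
    rw [PiLp.smul_apply, hm, smul_zero]
  · intro p hp q hpq
    have h1 := hsmul q 1
    rw [hpq, hsmul p 1] at h1
    have h0 : ∀ j, F.sweep p.1 ((1 / n p : ℝ) * (p.2 : ℂ)) (1 / n p) j ≠ 0 := fun j => by
      rw [← hsmul, one_smul]; exact hp j
    obtain ⟨e1, e2, e3⟩ := F.sweep_inj h1.symm h0 ((hq _ _).trans (hq _ _).symm)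
    rw [e3] at e2
    have h4 := mul_left_cancel₀
      (Complex.ofReal_ne_zero.2 (one_div_pos.2 (hn p)).ne') e2
    exact Prod.ext e1 (Circle.ext h4)

end EvenPeriodicSolution

/-! ### Recovering the data from the set `N` -/

/-- For a subset `S` of `ℂ³` and indices `j`, `j'`, the ratios `k` such that the points of `S` with
`z_{j'} = 0` come asymptotically close to the cone `|z₁|² = k |z_j|²`. -/
def asymptoticRatios (S : Set C3) (j j' : Fin 3) : Set ℝ :=
  {k | ∃ C : ℝ, ∀ R : ℝ, ∃ z ∈ S, z j' = 0 ∧ |‖z 0‖ ^ 2 - k * ‖z j‖ ^ 2| ≤ C ∧ R ≤ ‖z j‖ ^ 2}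

namespace EvenPeriodicSolution

variable (F : EvenPeriodicSolution)

lemma exists_ρ_max (j : Fin 3) : ∃ t₀, ∀ t, F.ρ j t ≤ F.ρ j t₀ := by
  obtain ⟨_, ⟨s, rfl⟩, hs⟩ := ((F.ρ_periodic j).compact_of_continuous F.T_pos.ne'
    (F.contDiff_ρ j).continuous).exists_isGreatest (Set.range_nonempty _)
  exact ⟨s, fun t => hs ⟨t, rfl⟩⟩

lemma exists_u_max : ∃ t₀, ∀ t, F.u t ≤ F.u t₀ := by
  obtain ⟨t₀, h⟩ := F.exists_ρ_max 0
  exact ⟨t₀, fun t => by simpa [Solution.ρ] using h t⟩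

/-- The extent of `N` along the coordinate axes determines `c`. -/
lemma le_of_N_subset {c c' : ℝ} (h : F.N c ⊆ F.N c') : (0 < c → c ≤ c') ∧ (c < 0 → c' ≤ c) := by
  constructor
  · intro hc
    obtain ⟨t₀, ht₀⟩ := F.exists_ρ_max 0
    obtain ⟨t, x, hx, hz⟩ := h ⟨t₀, ![√c, 0, 0], by
      simp [Fin.sum_univ_three, Real.sq_sqrt hc.le], rfl⟩
    have hj := fun j => congrFun (congrArg WithLp.ofLp hz) j
    have h1 : x 1 = 0 := F.point_apply_eq_zero.1 ((hj 1).symm.trans (F.point_apply_eq_zero.2 rfl))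
    have h2 : x 2 = 0 := F.point_apply_eq_zero.1 ((hj 2).symm.trans (F.point_apply_eq_zero.2 rfl))
    have h0 := congrArg (fun z : ℂ => ‖z‖ ^ 2) (hj 0)
    simp only [Solution.norm_point_apply_sq, Matrix.cons_val_zero, Real.sq_sqrt hc.le] at h0
    simp only [Fin.sum_univ_three, sgn_zero, sgn_one, sgn_two, h1, h2] at hx
    have h3 := ht₀ t
    have h4 := F.ρ_pos 0 t
    by_contra! hlt
    nlinarith [sq_nonneg (x 0)]
  · intro hc
    have hc' : 0 ≤ -c := by linarith
    obtain ⟨t₀, ht₀⟩ := F.exists_ρ_max 1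
    obtain ⟨t, x, hx, hz⟩ := h ⟨t₀, ![0, √(-c), 0], by
      simp [Fin.sum_univ_three, Real.sq_sqrt hc'], rfl⟩
    have hj := fun j => congrFun (congrArg WithLp.ofLp hz) j
    have h1 : x 0 = 0 := F.point_apply_eq_zero.1 ((hj 0).symm.trans (F.point_apply_eq_zero.2 rfl))
    have h2 : x 2 = 0 := F.point_apply_eq_zero.1 ((hj 2).symm.trans (F.point_apply_eq_zero.2 rfl))
    have h0 := congrArg (fun z : ℂ => ‖z‖ ^ 2) (hj 1)
    simp only [Solution.norm_point_apply_sq, Matrix.cons_val_one, Matrix.cons_val_zero,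
      Real.sq_sqrt hc'] at h0
    simp only [Fin.sum_univ_three, sgn_zero, sgn_one, sgn_two, h1, h2] at hx
    have h3 := ht₀ t
    have h4 := F.ρ_pos 1 t
    by_contra! hlt
    nlinarith [sq_nonneg (x 1)]

lemma N_injective : Function.Injective F.N := by
  intro c c' h
  obtain ⟨h1, h2⟩ := F.le_of_N_subset h.subset
  obtain ⟨h3, h4⟩ := F.le_of_N_subset h.symm.subset
  rcases lt_trichotomy c 0 with hc | rfl | hc
  · have := h2 hc
    exact le_antisymm (h4 (this.trans_lt hc)) this
  · rcases lt_trichotomy c' 0 with hc' | rfl | hc'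
    · exact absurd (h4 hc') (not_le.2 hc')
    · rfl
    · exact absurd (h3 hc') (not_le.2 hc')
  · have := h1 hc
    exact le_antisymm this (h3 (hc.trans_le this))

lemma asymptoticRatios_N (c : ℝ) {j j' : Fin 3} (hj : (j = 1 ∧ j' = 2) ∨ (j = 2 ∧ j' = 1)) :
    asymptoticRatios (F.N c) j j' = Set.range fun t => F.ρ 0 t / F.ρ j t := by
  have hsum : ∀ x : Fin 3 → ℝ, x j' = 0 → ∑ i, sgn i * x i ^ 2 = x 0 ^ 2 - x j ^ 2 := by
    intro x hx
    rw [Fin.sum_univ_three]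
    rcases hj with ⟨rfl, rfl⟩ | ⟨rfl, rfl⟩ <;> simp [hx] <;> ring
  ext k
  constructor
  · rintro ⟨C, hC⟩
    by_contra hk
    have hcont : Continuous fun t => F.ρ 0 t / F.ρ j t :=
      (F.contDiff_ρ 0).continuous.div (F.contDiff_ρ j).continuous fun t => (F.ρ_pos j t).ne'
    have hper : Function.Periodic (fun t => F.ρ 0 t / F.ρ j t) F.T := fun t => by
      simp only [F.ρ_periodic _ t]
    have hcl := (hper.compact_of_continuous F.T_pos.ne' hcont).isClosed
    obtain ⟨ε, hε, hball⟩ := Metric.isOpen_iff.1 hcl.isOpen_compl k hk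
    have hfar : ∀ t, ε ≤ |F.ρ 0 t / F.ρ j t - k| := fun t => by
      by_contra! hlt
      exact hball (Metric.mem_ball.2 (by rwa [Real.dist_eq])) ⟨t, rfl⟩
    obtain ⟨t₀, ht₀⟩ := F.exists_ρ_max 0
    obtain ⟨_, ⟨t, x, hx, rfl⟩, hz, hb, hR⟩ := hC ((C + |c| * F.ρ 0 t₀) / ε + 1)
    have hx' := hx
    rw [hsum x (F.point_apply_eq_zero.1 hz)] at hx'
    simp only [Solution.norm_point_apply_sq] at hb hR
    have hj0 := F.ρ_pos j t
    have e1 : x 0 ^ 2 * F.ρ 0 t - k * (x j ^ 2 * F.ρ j t) =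
        c * F.ρ 0 t + x j ^ 2 * F.ρ j t * (F.ρ 0 t / F.ρ j t - k) := by
      rw [← hx']
      field_simp
      ring
    rw [e1] at hb
    have e2 : |x j ^ 2 * F.ρ j t * (F.ρ 0 t / F.ρ j t - k)| ≤ C + |c| * F.ρ 0 t₀ := by
      have h1 := abs_sub_abs_le_abs_sub (x j ^ 2 * F.ρ j t * (F.ρ 0 t / F.ρ j t - k))
        (-(c * F.ρ 0 t))
      rw [sub_neg_eq_add, add_comm _ (c * F.ρ 0 t), abs_neg, abs_mul c,
        abs_of_pos (F.ρ_pos 0 t)] at h1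
      have h2 := mul_le_mul_of_nonneg_left (ht₀ t) (abs_nonneg c)
      linarith
    rw [abs_mul, abs_of_nonneg (by positivity)] at e2
    have e3 : x j ^ 2 * F.ρ j t * ε ≤ C + |c| * F.ρ 0 t₀ :=
      (mul_le_mul_of_nonneg_left (hfar t) (by positivity)).trans e2
    rw [← le_div_iff₀ hε] at e3
    linarith
  · rintro ⟨t, rfl⟩
    refine ⟨|c * F.ρ 0 t|, fun R => ?_⟩
    have hj0 := F.ρ_pos j t
    set s : ℝ := |c| + |R| / F.ρ j t
    have hs : 0 ≤ s := by positivity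
    have hcs : 0 ≤ c + s := by
      have := neg_abs_le c
      have : 0 ≤ |R| / F.ρ j t := by positivity
      simp only [s]; linarith
    let x : Fin 3 → ℝ := fun i => if i = 0 then √(c + s) else if i = j then √s else 0
    have hx0 : x 0 = √(c + s) := by simp [x]
    have hxj : x j = √s := by rcases hj with ⟨rfl, rfl⟩ | ⟨rfl, rfl⟩ <;> simp [x]
    have hxj' : x j' = 0 := by rcases hj with ⟨rfl, rfl⟩ | ⟨rfl, rfl⟩ <;> simp [x]
    refine ⟨F.point t x, ⟨t, x, ?_, rfl⟩, F.point_apply_eq_zero.2 hxj', ?_, ?_⟩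
    · rw [hsum x hxj', hx0, hxj, Real.sq_sqrt hcs, Real.sq_sqrt hs]; ring
    · simp only [Solution.norm_point_apply_sq, hx0, hxj, Real.sq_sqrt hcs, Real.sq_sqrt hs]
      refine le_of_eq (congrArg _ ?_)
      field_simp
      ring
    · rw [Solution.norm_point_apply_sq, hxj, Real.sq_sqrt hs]
      simp only [s, add_mul, div_mul_cancel₀ _ hj0.ne']
      have := le_abs_self R
      have := mul_nonneg (abs_nonneg c) hj0.le
      linarith

end EvenPeriodicSolution

/-- On a line `α + s d` in the direction of the signs, the normalization `1/α₁ = 1/α₂ + 1/α₃` is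
satisfied at one point only. -/
lemma eq_zero_of_normalized {α : Fin 3 → ℝ} {d : ℝ} (hα : ∀ j, 0 < α j)
    (hαd : ∀ j, 0 < α j + sgn j * d) (h : ∑ j, sgn j / α j = 0)
    (hd : ∑ j, sgn j / (α j + sgn j * d) = 0) : d = 0 := by
  have h0 := hα 0
  have h1 := hα 1
  have h2 := hα 2
  have g0 := hαd 0
  have g1 := hαd 1
  have g2 := hαd 2
  simp only [Fin.sum_univ_three, sgn_zero, sgn_one, sgn_two, one_mul, neg_one_mul, neg_div] at *
  rcases lt_trichotomy d 0 with hneg | hd0 | hpos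
  · have e0 := one_div_lt_one_div_of_lt g0 (show α 0 + d < α 0 by linarith)
    have e1 := one_div_lt_one_div_of_lt h1 (show α 1 < α 1 + -d by linarith)
    have e2 := one_div_lt_one_div_of_lt h2 (show α 2 < α 2 + -d by linarith)
    linarith
  · exact hd0
  · have e0 := one_div_lt_one_div_of_lt h0 (show α 0 < α 0 + d by linarith)
    have e1 := one_div_lt_one_div_of_lt g1 (show α 1 + -d < α 1 by linarith)
    have e2 := one_div_lt_one_div_of_lt g2 (show α 2 + -d < α 2 by linarith)
    linarith

namespace Solution

lemma B_eq_zero_of_max (D : Solution) {t₀ : ℝ} (h : ∀ t, D.u t ≤ D.u t₀) : D.B t₀ = 0 := by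
  have hm : IsLocalMax D.u t₀ := Filter.Eventually.of_forall h
  have := hm.hasDerivAt_eq_zero (D.hasDerivAt_u t₀)
  linarith

/-- Solutions whose parameters, and whose values at a maximum of `u`, are proportional with ratio
`σ²` agree up to scaling, time shifts and constant rotations. -/
lemma eq_of_scaling (D E : Solution) {σ t₀ s₀ : ℝ} (hσ : 0 < σ)
    (hα : ∀ j, E.α j = σ ^ 2 * D.α j) (hu : E.u s₀ = σ ^ 2 * D.u t₀) (hD : ∀ t, D.u t ≤ D.u t₀)
    (hE : ∀ t, E.u t ≤ E.u s₀) (s : ℝ) :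
    E.u (s₀ + s / σ) = σ ^ 2 * D.u (t₀ + s) ∧
      ∀ j, E.θ j (s₀ + s / σ) - E.θ j s₀ = D.θ j (t₀ + s) - D.θ j t₀ := by
  have hBD := D.B_eq_zero_of_max hD
  have hBE := E.B_eq_zero_of_max hE
  have hA : E.A = σ ^ 3 * D.A := by
    have h1 := D.A_sq_add_B_sq t₀
    have h2 := E.A_sq_add_B_sq s₀
    rw [hBD, Q_eq] at h1
    rw [hBE, Q_eq, hα, hα, hα, hu] at h2
    have h3 : E.A ^ 2 = (σ ^ 3 * D.A) ^ 2 := by linear_combination h2 - σ ^ 6 * h1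
    have h4 := D.A_pos'
    have h5 := E.A_pos'
    rwa [sq_eq_sq₀ h5.le (by positivity)] at h3
  obtain ⟨R₁, hR₁⟩ := D.exists_bound
  obtain ⟨R₂, hR₂⟩ := E.exists_bound
  have hlin : ∀ s, HasDerivAt (fun s => s₀ + s / σ) (1 / σ) s := fun s =>
    ((hasDerivAt_id s).div_const σ).const_add s₀
  have hQ' : ∀ v, Q' E.α v = σ ^ 4 * Q' D.α (v / σ ^ 2) := fun v => by
    simp only [Q', hα]
    field_simp
  have key := eq_of_hamiltonian (α := D.α) (R := max R₁ (max (R₂ / σ ^ 2) (R₂ / σ ^ 3)))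
    (u₁ := fun s => E.u (s₀ + s / σ) / σ ^ 2) (B₁ := fun s => E.B (s₀ + s / σ) / σ ^ 3)
    (u₂ := fun s => D.u (t₀ + s)) (B₂ := fun s => D.B (t₀ + s))
    (fun s => (((E.hasDerivAt_u _).comp s (hlin s)).div_const _).congr_deriv (by field_simp))
    (fun s => (((E.hasDerivAt_B _).comp s (hlin s)).div_const _).congr_deriv
      (by rw [hQ']; field_simp))
    (fun s => (D.hasDerivAt_u (t₀ + s)).comp_const_add t₀ s)
    (fun s => (D.hasDerivAt_B (t₀ + s)).comp_const_add t₀ s)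
    (fun s => by
      rw [abs_div, abs_of_pos (pow_pos hσ 2)]
      exact le_max_of_le_right (le_max_of_le_left (by have := (hR₂ (s₀ + s / σ)).1; gcongr)))
    (fun s => by
      rw [abs_div, abs_of_pos (pow_pos hσ 3)]
      exact le_max_of_le_right (le_max_of_le_right (by have := (hR₂ (s₀ + s / σ)).2; gcongr)))
    (fun s => le_max_of_le_left (hR₁ _).1) (fun s => le_max_of_le_left (hR₁ _).2)
    (by simp only [zero_div, add_zero, hu]; field_simp) (by simp [hBD, hBE])
  have hus : ∀ s, E.u (s₀ + s / σ) = σ ^ 2 * D.u (t₀ + s) := fun s => by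
    rw [← (key s).1, mul_div_cancel₀ _ (pow_pos hσ 2).ne']
  refine ⟨hus s, fun j => ?_⟩
  have hd : ∀ s, HasDerivAt (fun s => E.θ j (s₀ + s / σ) - D.θ j (t₀ + s)) 0 s := fun s => by
    refine (((E.hasDerivAt_θ j _).comp s (hlin s)).sub
      ((D.hasDerivAt_θ j (t₀ + s)).comp_const_add t₀ s)).congr_deriv ?_
    have h1 : E.ρ j (s₀ + s / σ) = σ ^ 2 * D.ρ j (t₀ + s) := by
      rw [ρ, ρ, hus, hα]; ring
    have h2 := (D.ρ_pos j (t₀ + s)).ne'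
    rw [h1, hA]
    field_simp
    ring
  have h := is_const_of_deriv_eq_zero (fun s => (hd s).differentiableAt)
    (fun s => (hd s).deriv) s 0
  simp only [zero_div, add_zero] at h
  linarith

end Solution

namespace EvenPeriodicSolution

lemma θ_add_T (F : EvenPeriodicSolution) (j : Fin 3) (t : ℝ) :
    F.θ j (t + F.T) - F.θ j t = F.β j := by
  rw [F.shift, β]; ring

/-- The set `N` determines the rotation angles: its asymptotic ratios determine the maximum of
`ρ₁/ρ₂` and `ρ₁/ρ₃`, hence the parameters and the maximum of `u` up to scale. -/
lemma β_eq_of_N_eq {F G : EvenPeriodicSolution} {c c' : ℝ} (h : F.N c = G.N c') : F.β = G.β := by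
  obtain ⟨t₀, ht₀⟩ := F.exists_u_max
  obtain ⟨s₀, hs₀⟩ := G.exists_u_max
  -- the ratio `ρ₁ / ρⱼ` is increasing in `u`
  have hmax : ∀ (K : EvenPeriodicSolution) (r₀ : ℝ), (∀ t, K.u t ≤ K.u r₀) → ∀ j, j = 1 ∨ j = 2 →
      IsGreatest (Set.range fun t => K.ρ 0 t / K.ρ j t) (K.ρ 0 r₀ / K.ρ j r₀) := by
    rintro K r₀ hr₀ j hj
    refine ⟨⟨r₀, rfl⟩, ?_⟩
    rintro _ ⟨t, rfl⟩
    have h1 := hr₀ t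
    have h2 : K.ρ j r₀ ≤ K.ρ j t := by
      rcases hj with rfl | rfl <;> simp only [Solution.ρ, sgn_one, sgn_two] <;> linarith
    have h3 : K.ρ 0 t ≤ K.ρ 0 r₀ := by simp only [Solution.ρ, sgn_zero]; linarith
    exact div_le_div₀ (K.ρ_pos 0 _).le h3 (K.ρ_pos j _) h2
  have hrat : ∀ j, j = 1 ∨ j = 2 → F.ρ 0 t₀ / F.ρ j t₀ = G.ρ 0 s₀ / G.ρ j s₀ := by
    intro j hj
    have h1 := hmax F t₀ ht₀ j hj
    have h2 := hmax G s₀ hs₀ j hj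
    obtain ⟨j', hj'⟩ : ∃ j' : Fin 3, (j = 1 ∧ j' = 2) ∨ (j = 2 ∧ j' = 1) := by
      rcases hj with rfl | rfl
      exacts [⟨2, Or.inl ⟨rfl, rfl⟩⟩, ⟨1, Or.inr ⟨rfl, rfl⟩⟩]
    rw [← asymptoticRatios_N _ c hj', h] at h1
    rw [← asymptoticRatios_N _ c' hj'] at h2
    exact h1.unique h2
  set p : ℝ := G.ρ 0 s₀ / F.ρ 0 t₀ with hp
  have hp0 : 0 < p := div_pos (G.ρ_pos 0 _) (F.ρ_pos 0 _)
  have hρ : ∀ j, G.ρ j s₀ = p * F.ρ j t₀ := by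
    have h0 := (F.ρ_pos 0 t₀).ne'
    have hj : ∀ j, j = 1 ∨ j = 2 → G.ρ j s₀ = p * F.ρ j t₀ := fun j hj => by
      have h1 := hrat j hj
      have h2 := (F.ρ_pos j t₀).ne'
      have h3 := (G.ρ_pos j s₀).ne'
      rw [hp]
      field_simp at h1 ⊢
      linarith
    intro j
    fin_cases j
    · rw [hp]; field_simp; rfl
    · exact hj 1 (Or.inl rfl)
    · exact hj 2 (Or.inr rfl)
  -- the parameters of `G` differ from the rescaled ones of `F` by a translation along the signs
  set d := p * F.u t₀ - G.u s₀ with hd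
  have hαd : ∀ j, G.α j = p * F.α j + sgn j * d := fun j => by
    have := hρ j
    simp only [Solution.ρ] at this
    rw [hd]; linear_combination this
  have hd0 : d = 0 := by
    refine eq_zero_of_normalized (α := fun j => p * F.α j) (fun j => mul_pos hp0 (F.α_pos j))
      (fun j => by rw [← hαd]; exact G.α_pos j) ?_ (by simp only [← hαd]; exact G.α_normalized)
    have h1 := congrArg (fun r => r / p) F.α_normalized
    simp only [Finset.sum_div, zero_div] at h1
    rw [← h1]
    refine Finset.sum_congr rfl fun j _ => ?_
    rw [div_div, mul_comm]
  set σ := √p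
  have hσ : 0 < σ := Real.sqrt_pos.2 hp0
  have hσ2 : σ ^ 2 = p := Real.sq_sqrt hp0.le
  have key := F.eq_of_scaling G.toSolution hσ (t₀ := t₀) (s₀ := s₀)
    (fun j => by rw [hαd, hd0, hσ2]; ring) (by rw [hσ2]; linarith) ht₀ hs₀
  have keyΘ : ∀ s, G.Θ (s₀ + s / σ) - G.Θ s₀ = F.Θ (t₀ + s) - F.Θ t₀ := fun s => by
    simp only [Solution.Θ, ← Finset.sum_sub_distrib, (key s).2]
  have hT : F.T = σ * G.T := by
    refine le_antisymm (F.period.2 ⟨mul_pos hσ G.T_pos, fun t => ?_, fun t => ?_⟩) ?_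
    · have h1 := (key (t - t₀)).1
      have h2 := (key (t - t₀ + σ * G.T)).1
      rw [show s₀ + (t - t₀ + σ * G.T) / σ = s₀ + (t - t₀) / σ + G.T by field_simp; ring,
        G.u_periodic, h1, show t₀ + (t - t₀) = t by ring,
        show t₀ + (t - t₀ + σ * G.T) = t + σ * G.T by ring] at h2
      exact (mul_left_cancel₀ (pow_pos hσ 2).ne' h2).symm
    · have h1 := keyΘ (t - t₀)
      have h2 := keyΘ (t - t₀ + σ * G.T)
      rw [show s₀ + (t - t₀ + σ * G.T) / σ = s₀ + (t - t₀) / σ + G.T by field_simp; ring,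
        G.Θ_periodic, h1, show t₀ + (t - t₀) = t by ring,
        show t₀ + (t - t₀ + σ * G.T) = t + σ * G.T by ring] at h2
      exact (sub_left_injective h2).symm
    · rw [← le_div_iff₀' hσ]
      refine G.period.2 ⟨div_pos F.T_pos hσ, fun t => ?_, fun t => ?_⟩
      · have h1 := (key (σ * (t - s₀))).1
        have h2 := (key (σ * (t - s₀) + F.T)).1
        rw [← add_assoc, F.u_periodic, ← h1,
          show s₀ + (σ * (t - s₀) + F.T) / σ = t + F.T / σ by field_simp; ring,
          show s₀ + σ * (t - s₀) / σ = t by field_simp; ring] at h2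
        exact h2
      · have h1 := keyΘ (σ * (t - s₀))
        have h2 := keyΘ (σ * (t - s₀) + F.T)
        rw [← add_assoc, F.Θ_periodic, ← h1,
          show s₀ + (σ * (t - s₀) + F.T) / σ = t + F.T / σ by field_simp; ring,
          show s₀ + σ * (t - s₀) / σ = t by field_simp; ring] at h2
        exact sub_left_injective h2
  funext j
  have h1 := (key F.T).2 j
  rw [F.θ_add_T, hT, mul_div_cancel_left₀ _ hσ.ne', G.θ_add_T] at h1
  exact h1.symm

end EvenPeriodicSolution

/-! ### One-dimensional flows -/

/-- A positive bounded autonomous equation `φ' = g(φ)` is solved by inverting `x ↦ ∫₀ˣ 1/g`. -/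
lemma exists_flow {g : ℝ → ℝ} {C : ℝ} (hg : Continuous g) (h0 : ∀ x, 0 < g x)
    (hC : ∀ x, g x ≤ C) : ∃ φ : ℝ → ℝ, StrictMono φ ∧ (∀ t, HasDerivAt φ (g (φ t)) t) ∧
      (∀ x, φ (∫ y in (0 : ℝ)..x, (g y)⁻¹) = x) ∧ ∀ t, ∫ y in (0 : ℝ)..φ t, (g y)⁻¹ = t := by
  set τ : ℝ → ℝ := fun x => ∫ y in (0 : ℝ)..x, (g y)⁻¹ with hτ
  have hgi : Continuous fun x => (g x)⁻¹ := hg.inv₀ fun x => (h0 x).ne'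
  have hd : ∀ x, HasDerivAt τ (g x)⁻¹ x := fun x => hgi.integral_hasStrictDerivAt 0 x |>.hasDerivAt
  have hmono : StrictMono τ := strictMono_of_hasDerivAt_pos hd fun x => inv_pos.2 (h0 x)
  have hcont : Continuous τ := continuous_iff_continuousAt.2 fun x => (hd x).continuousAt
  have hC0 : 0 < C := (h0 0).trans_le (hC 0)
  have hle : ∀ x y, x ≤ y → (y - x) / C ≤ τ y - τ x := fun x y hxy => by
    have h1 : ∫ _ in x..y, C⁻¹ ≤ ∫ z in x..y, (g z)⁻¹ :=
      intervalIntegral.integral_mono_on hxy (by simp) (hgi.intervalIntegrable _ _)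
        fun z _ => inv_anti₀ (h0 z) (hC z)
    rw [intervalIntegral.integral_const, smul_eq_mul, ← div_eq_mul_inv] at h1
    rwa [hτ, intervalIntegral.integral_interval_sub_left (hgi.intervalIntegrable _ _)
      (hgi.intervalIntegrable _ _)]
  have hτ0 : τ 0 = 0 := by simp [hτ]
  have hsurj : Function.Surjective τ := fun t => by
    refine mem_range_of_exists_le_of_exists_ge hcont ⟨-(C * |t|), ?_⟩ ⟨C * |t|, ?_⟩
    · have h1 := hle (-(C * |t|)) 0 (by have := mul_nonneg hC0.le (abs_nonneg t); linarith)
      rw [hτ0, show (0 - -(C * |t|)) / C = |t| by field_simp; ring] at h1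
      have := neg_abs_le t
      linarith
    · have h1 := hle 0 (C * |t|) (by positivity)
      rw [hτ0, show (C * |t| - 0) / C = |t| by field_simp; ring] at h1
      have := le_abs_self t
      linarith
  let e := hmono.orderIsoOfSurjective τ hsurj
  refine ⟨e.symm, e.symm.strictMono, fun t => ?_, fun x => e.symm_apply_apply x,
    fun t => e.apply_symm_apply t⟩
  have h1 := HasDerivAt.of_local_left_inverse (f := τ) (g := e.symm) (a := t)
    e.symm.continuous.continuousAt (hd _) (inv_pos.2 (h0 _)).ne'
    (Filter.Eventually.of_forall fun t => e.apply_symm_apply t)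
  rwa [inv_inv] at h1

/-! ### A family of periodic solutions

For `α = (1, 2, 2)` one has `Q(u) - A² = (u + m)(u - u₂)(u - u₃)`, where `-m` is the minimum of
`u`, and `u = -m + (m + u₂) sin² φ` reduces the equation `u'² = 4 (Q(u) - A²)` to a
one-dimensional flow for `φ`. -/

/-- The square root of the discriminant of the quadratic polynomial with roots `u₂`, `u₃`. -/
def rootGap (m : ℝ) : ℝ := √(3 * (3 + m) * (1 - m))

/-- The maximum `u₂` of `u`. -/
def root₂ (m : ℝ) : ℝ := (3 + m - rootGap m) / 2

/-- The largest root `u₃` of `Q - A²`. -/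
def root₃ (m : ℝ) : ℝ := (3 + m + rootGap m) / 2

/-- The value of the conserved quantity `A`, for which `A² = Q(-m) = (1 - m) (2 + m)²`. -/
def consA (m : ℝ) : ℝ := √(1 - m) * (2 + m)

/-- The value of `u` as a function of the angle `φ`. -/
def profile (m x : ℝ) : ℝ := -m + (m + root₂ m) * Real.sin x ^ 2

/-- The speed of the angle `φ`. -/
def speed (m x : ℝ) : ℝ := √(root₃ m - profile m x)

/-- The density of `-θ₁` with respect to the angle `φ`. -/
def density (m x : ℝ) : ℝ := consA m / ((1 + profile m x) * speed m x)

section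

variable {m : ℝ}

lemma rootGap_sq (h0 : 0 ≤ m) (h1 : m < 1) : rootGap m ^ 2 = 3 * (3 + m) * (1 - m) :=
  Real.sq_sqrt (by nlinarith)

lemma rootGap_pos (h0 : 0 ≤ m) (h1 : m < 1) : 0 < rootGap m := Real.sqrt_pos.2 (by nlinarith)

lemma consA_pos (h0 : 0 ≤ m) (h1 : m < 1) : 0 < consA m :=
  mul_pos (Real.sqrt_pos.2 (by linarith)) (by linarith)

lemma consA_sq (h1 : m < 1) : consA m ^ 2 = (1 - m) * (2 + m) ^ 2 := by
  rw [consA, mul_pow, Real.sq_sqrt (by linarith)]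

lemma root₂_nonneg (h0 : 0 ≤ m) (h1 : m < 1) : 0 ≤ root₂ m := by
  have := rootGap_sq h0 h1
  have := rootGap_pos h0 h1
  have : rootGap m ≤ 3 + m := by
    by_contra! h
    nlinarith
  unfold root₂; linarith

lemma root₂_lt_two (h0 : 0 ≤ m) (h1 : m < 1) : root₂ m < 2 := by
  have := rootGap_sq h0 h1
  have := rootGap_pos h0 h1
  have : m - 1 < rootGap m := by linarith
  unfold root₂; linarith

lemma profile_bounds (h0 : 0 ≤ m) (h1 : m < 1) (x : ℝ) :
    -m ≤ profile m x ∧ profile m x ≤ root₂ m := by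
  have h2 := root₂_nonneg h0 h1
  have h3 := sq_nonneg (Real.sin x)
  have h4 := Real.sin_sq_le_one x
  unfold profile
  constructor <;> nlinarith

lemma root₃_sub_pos (h0 : 0 ≤ m) (h1 : m < 1) (x : ℝ) : 0 < root₃ m - profile m x := by
  have := (profile_bounds h0 h1 x).2
  have := rootGap_pos h0 h1
  unfold root₂ at *
  unfold root₃
  linarith

lemma speed_pos (h0 : 0 ≤ m) (h1 : m < 1) (x : ℝ) : 0 < speed m x :=
  Real.sqrt_pos.2 (root₃_sub_pos h0 h1 x)

lemma continuous_profile : Continuous (profile m) := by unfold profile; fun_prop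

lemma continuous_speed : Continuous (speed m) := (continuous_const.sub continuous_profile).sqrt

lemma one_add_profile_pos (h0 : 0 ≤ m) (h1 : m < 1) (x : ℝ) : 0 < 1 + profile m x := by
  have := (profile_bounds h0 h1 x).1
  linarith

lemma continuous_density (h0 : 0 ≤ m) (h1 : m < 1) : Continuous (density m) :=
  continuous_const.div ((continuous_const.add continuous_profile).mul continuous_speed)
    fun x => (mul_pos (one_add_profile_pos h0 h1 x) (speed_pos h0 h1 x)).ne'

lemma profile_periodic : Function.Periodic (profile m) Real.pi := fun x => by
  simp [profile, Real.sin_add_pi]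

lemma speed_periodic : Function.Periodic (speed m) Real.pi := fun x => by
  rw [speed, profile_periodic, speed]

lemma density_periodic : Function.Periodic (density m) Real.pi := fun x => by
  rw [density, profile_periodic, speed_periodic, density]

/-- The increment of `-θ₁` over a period, so that `β₁ = -angle m`. As `u` has period `π` in `φ`, the
period in `t` corresponds to `0 ≤ φ ≤ π`. -/
def angle (m : ℝ) : ℝ := ∫ x in (0 : ℝ)..Real.pi, density m x

lemma integral_add_pi {f : ℝ → ℝ} (hf : Continuous f) (hp : Function.Periodic f Real.pi) (x : ℝ) :
    ∫ y in (0 : ℝ)..(x + Real.pi), f y =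
      (∫ y in (0 : ℝ)..x, f y) + ∫ y in (0 : ℝ)..Real.pi, f y := by
  rw [← intervalIntegral.integral_add_adjacent_intervals (b := x) (hf.intervalIntegrable _ _)
    (hf.intervalIntegrable _ _), hp.intervalIntegral_add_eq x 0, zero_add]

/-- The parameters `α` of the family. -/
def familyα : Fin 3 → ℝ := ![1, 2, 2]

lemma Q_familyα (v : ℝ) : Q familyα v = (1 + v) * (2 - v) * (2 - v) := by
  simp [Q_eq, familyα]

/-- The value of `B` as a function of the angle `φ`. -/
def profileB (m x : ℝ) : ℝ := (m + root₂ m) * (Real.sin x * Real.cos x) * speed m x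

lemma root₂_add_root₃ : root₂ m + root₃ m = 3 + m := by unfold root₂ root₃; ring

lemma root₂_mul_root₃ (h0 : 0 ≤ m) (h1 : m < 1) : root₂ m * root₃ m = m * (3 + m) := by
  have hg := rootGap_sq h0 h1
  unfold root₂ root₃
  linear_combination (-(1 / 4) : ℝ) * hg

lemma speed_sq (h0 : 0 ≤ m) (h1 : m < 1) (x : ℝ) : speed m x ^ 2 = root₃ m - profile m x :=
  Real.sq_sqrt (root₃_sub_pos h0 h1 x).le

lemma root₂_sub_profile (x : ℝ) : root₂ m - profile m x = (m + root₂ m) * Real.cos x ^ 2 := by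
  rw [Real.cos_sq', profile]; ring

lemma consA_sq_add_profileB_sq (h0 : 0 ≤ m) (h1 : m < 1) (x : ℝ) :
    consA m ^ 2 + profileB m x ^ 2 = Q familyα (profile m x) := by
  have h : profileB m x ^ 2 =
      (profile m x + m) * ((root₂ m - profile m x) * (root₃ m - profile m x)) := by
    rw [← speed_sq h0 h1, root₂_sub_profile, profileB, profile]; ring
  have e1 := root₂_add_root₃ (m := m)
  have e2 := root₂_mul_root₃ h0 h1
  rw [h, Q_familyα, consA_sq h1]
  linear_combination (profile m x + m) * (e2 - profile m x * e1)

lemma hasDerivAt_profile (x : ℝ) : HasDerivAt (profile m)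
    ((m + root₂ m) * (2 * (Real.sin x * Real.cos x))) x := by
  have h := (((Real.hasDerivAt_sin x).fun_pow 2).const_mul (m + root₂ m)).const_add (-m)
  refine h.congr_deriv ?_
  norm_num only [pow_one]
  ring

lemma hasDerivAt_speed (h0 : 0 ≤ m) (h1 : m < 1) (x : ℝ) : HasDerivAt (speed m)
    (-((m + root₂ m) * (Real.sin x * Real.cos x) / speed m x)) x := by
  have h := ((hasDerivAt_profile (m := m) x).const_sub (root₃ m)).sqrt (root₃_sub_pos h0 h1 x).ne'
  refine h.congr_deriv ?_
  have := (speed_pos h0 h1 x).ne'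
  change _ / (2 * speed m x) = _
  field_simp

lemma hasDerivAt_profileB (h0 : 0 ≤ m) (h1 : m < 1) (x : ℝ) : HasDerivAt (profileB m)
    (Q' familyα (profile m x) / speed m x) x := by
  have h := ((((Real.hasDerivAt_sin x).fun_mul (Real.hasDerivAt_cos x)).const_mul
    (m + root₂ m))).fun_mul (hasDerivAt_speed h0 h1 x)
  refine h.congr_deriv ?_
  have hs := (speed_pos h0 h1 x).ne'
  have e0 := speed_sq h0 h1 x
  have e1 := root₂_add_root₃ (m := m)
  have e2 := root₂_mul_root₃ h0 h1
  have e3 := root₂_sub_profile (m := m) x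
  have e4 : profile m x + m = (m + root₂ m) * Real.sin x ^ 2 := by unfold profile; ring
  have e5 : Q' familyα (profile m x) = (profile m x - root₂ m) * (profile m x - root₃ m) +
      (profile m x + m) * (profile m x - root₃ m) +
      (profile m x + m) * (profile m x - root₂ m) := by
    simp only [Q', familyα, Matrix.cons_val_zero, Matrix.cons_val_one, Matrix.cons_val]
    linear_combination (2 * profile m x + m) * e1 - e2
  rw [e5, show profile m x - root₂ m = -((m + root₂ m) * Real.cos x ^ 2) by linarith, e4,
    show profile m x - root₃ m = -speed m x ^ 2 by linarith]
  field_simp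

lemma profileB_periodic : Function.Periodic (profileB m) Real.pi := fun x => by
  simp [profileB, speed_periodic x, Real.sin_add_pi, Real.cos_add_pi]

/-- The solution with `α = (1, 2, 2)` on which `u` has minimum `-m`. -/
lemma exists_solution (h0 : 0 < m) (h1 : m < 1) : ∃ (D : Solution) (T : ℝ),
    IsLeast {S : ℝ | 0 < S ∧ Function.Periodic D.u S ∧
      Function.Periodic (fun t => ∑ i, D.θ i t) S} T ∧
    (∀ t, D.θ 0 (t + T) = D.θ 0 t - angle m) ∧ (∀ t, D.θ 1 (t + T) = D.θ 1 t + angle m / 2) ∧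
    ∀ t, D.θ 2 (t + T) = D.θ 2 t + angle m / 2 := by
  obtain ⟨φ, hmono, hφ, hφτ, hτφ⟩ := exists_flow (g := speed m) (C := √(root₃ m + m))
    continuous_speed (speed_pos h0.le h1) fun x =>
      Real.sqrt_le_sqrt (by linarith [(profile_bounds h0.le h1 x).1])
  have hA := consA_pos h0.le h1
  set A := consA m with hAdef
  set u : ℝ → ℝ := fun t => profile m (φ t) with hu
  set B : ℝ → ℝ := fun t => profileB m (φ t) with hB
  set Θ : ℝ → ℝ := fun t => Real.pi / 2 - Real.arctan (B t / A) with hΘ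
  set θ₁ : ℝ → ℝ := fun t => -∫ x in (0 : ℝ)..φ t, density m x with hθ₁
  set θ : Fin 3 → ℝ → ℝ := ![θ₁, fun t => (Θ t - θ₁ t) / 2, fun t => (Θ t - θ₁ t) / 2] with hθ
  have hsum : ∀ t, ∑ i, θ i t = Θ t := fun t => by
    simp [hθ, Fin.sum_univ_three]; ring
  have hu1 : ∀ t, 0 < 1 + u t := fun t => one_add_profile_pos h0.le h1 _
  have hu2 : ∀ t, 0 < 2 - u t := fun t => by
    have := (profile_bounds h0.le h1 (φ t)).2
    have := root₂_lt_two h0.le h1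
    simp only [hu]; linarith
  have hQ : ∀ t, A ^ 2 + B t ^ 2 = Q familyα (u t) :=
    fun t => consA_sq_add_profileB_sq h0.le h1 (φ t)
  have hQpos : ∀ t, 0 < Q familyα (u t) := fun t => by rw [← hQ]; positivity
  have hsq : ∀ t, √(1 + (B t / A) ^ 2) = √(Q familyα (u t)) / A := fun t => by
    rw [← hQ, show 1 + (B t / A) ^ 2 = (A ^ 2 + B t ^ 2) / A ^ 2 by field_simp,
      Real.sqrt_div (by positivity), Real.sqrt_sq hA.le]
  have hsin : ∀ t, √(Q familyα (u t)) * Real.sin (Θ t) = A := fun t => by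
    have := (Real.sqrt_pos.2 (hQpos t)).ne'
    rw [hΘ, Real.sin_pi_div_two_sub, Real.cos_arctan, hsq]
    field_simp
  have hcos : ∀ t, √(Q familyα (u t)) * Real.cos (Θ t) = B t := fun t => by
    have := (Real.sqrt_pos.2 (hQpos t)).ne'
    rw [hΘ, Real.cos_pi_div_two_sub, Real.sin_arctan, hsq]
    field_simp
  have hsp : ∀ t, speed m (φ t) ≠ 0 := fun t => (speed_pos h0.le h1 _).ne'
  have hdu : ∀ t, HasDerivAt u (2 * B t) t := fun t => by
    refine ((hasDerivAt_profile (φ t)).comp t (hφ t)).congr_deriv ?_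
    simp only [hB, profileB]; ring
  have hdB : ∀ t, HasDerivAt B (Q' familyα (u t)) t := fun t => by
    refine ((hasDerivAt_profileB h0.le h1 (φ t)).comp t (hφ t)).congr_deriv ?_
    exact div_mul_cancel₀ _ (hsp t)
  have hdΘ : ∀ t, HasDerivAt Θ (-(A * Q' familyα (u t) / Q familyα (u t))) t := fun t => by
    refine (((hdB t).div_const A).arctan.const_sub (Real.pi / 2)).congr_deriv ?_
    have := (hQpos t).ne'
    rw [show 1 + (B t / A) ^ 2 = Q familyα (u t) / A ^ 2 by rw [← hQ]; field_simp]
    field_simp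
  have hdθ₁ : ∀ t, HasDerivAt θ₁ (-(A / (1 + u t))) t := fun t => by
    have h := ((continuous_density h0.le h1).integral_hasStrictDerivAt 0 (φ t)).hasDerivAt
    refine (h.comp t (hφ t)).neg.congr_deriv ?_
    have := hsp t
    have := (hu1 t).ne'
    simp only [density, ← hAdef]
    change -(A / ((1 + u t) * speed m (φ t)) * speed m (φ t)) = _
    field_simp
  have hdθ₂ : ∀ t, HasDerivAt (fun t => (Θ t - θ₁ t) / 2) (A / (2 - u t)) t := fun t => by
    refine (((hdΘ t).sub (hdθ₁ t)).div_const 2).congr_deriv ?_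
    have h3 := (hu1 t).ne'
    have h4 := (hu2 t).ne'
    have h5 : Q' familyα (u t) = (2 - u t) * (2 - u t) - 2 * ((1 + u t) * (2 - u t)) := by
      simp only [Q', familyα, Matrix.cons_val_zero, Matrix.cons_val_one, Matrix.cons_val]
      ring
    rw [Q_familyα, h5]
    field_simp
    ring
  set T : ℝ := ∫ y in (0 : ℝ)..Real.pi, (speed m y)⁻¹ with hT
  have hsi : Continuous fun y => (speed m y)⁻¹ :=
    continuous_speed.inv₀ fun y => (speed_pos h0.le h1 y).ne'
  have hφT : ∀ t, φ (t + T) = φ t + Real.pi := fun t => by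
    rw [← hφτ (φ t + Real.pi), integral_add_pi hsi (fun x => by rw [speed_periodic]), hτφ]
  have hφ0 : φ 0 = 0 := by simpa using hφτ 0
  have hφT0 : φ T = Real.pi := hφτ Real.pi
  have huT : Function.Periodic u T := fun t => by
    simp only [hu, hφT, profile_periodic (φ t)]
  have hΘT : Function.Periodic Θ T := fun t => by
    simp only [hΘ, hB, hφT, profileB_periodic (φ t)]
  have hθ₁T : ∀ t, θ₁ (t + T) = θ₁ t - angle m := fun t => by
    simp only [hθ₁, hφT, integral_add_pi (continuous_density h0.le h1) density_periodic, angle]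
    ring
  refine ⟨⟨familyα, u, θ, ?_, ?_, ?_, fun t => ?_, ?_, ?_, ?_⟩, T, ⟨⟨?_, huT, ?_⟩, ?_⟩,
    hθ₁T, fun t => ?_, fun t => ?_⟩
  · intro j; fin_cases j <;> simp [familyα]
  · simp [Fin.sum_univ_three, familyα, sgn]; norm_num
  · intro j t
    fin_cases j
    · simpa [familyα, sgn] using hu1 t
    · simpa [familyα, sgn] using hu2 t
    · simpa [familyα, sgn] using hu2 t
  · rw [hsum, mul_assoc, hcos]; exact hdu t
  · intro j t
    rw [hsum, hsin]
    fin_cases j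
    · refine (hdθ₁ t).congr_deriv ?_
      simp [familyα, sgn]
    · refine (hdθ₂ t).congr_deriv ?_
      simp [familyα, sgn, neg_div, sub_eq_add_neg]
    · refine (hdθ₂ t).congr_deriv ?_
      simp [familyα, sgn, neg_div, sub_eq_add_neg]
  · rw [hsum, hsin]; exact hA
  · rw [hsum, hsin]
    refine Real.lt_sqrt_of_sq_lt ?_
    rw [consA_sq h1]
    simp [Fin.prod_univ_three, familyα]
    nlinarith [mul_pos h0 h0]
  · by_contra! h
    have := hmono.monotone h
    rw [hφT0, hφ0] at this
    linarith [Real.pi_pos]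
  · intro t
    simp only [hsum]
    exact hΘT t
  · rintro S ⟨hS, hSu, -⟩
    have h2 : profile m (φ S) = profile m 0 := by
      have := hSu 0
      simpa only [hu, zero_add, hφ0] using this
    have h3 : Real.sin (φ S) = 0 := by
      have : (m + root₂ m) * Real.sin (φ S) ^ 2 = 0 := by
        simp [profile] at h2 ⊢; exact h2
      have h4 : m + root₂ m ≠ 0 := by linarith [root₂_nonneg h0.le h1]
      exact pow_eq_zero_iff two_ne_zero |>.1 ((mul_eq_zero.1 this).resolve_left h4)
    obtain ⟨n, hn⟩ := Real.sin_eq_zero_iff.1 h3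
    have h5 : 0 < φ S := hφ0 ▸ hmono hS
    rw [← hn] at h5
    have h6 : (0 : ℝ) < n := pos_of_mul_pos_left h5 Real.pi_pos.le
    have h7 : (1 : ℝ) ≤ n := by exact_mod_cast (Int.cast_pos.1 h6 : 0 < n)
    rw [← hmono.le_iff_le, hφT0, ← hn]
    nlinarith [Real.pi_pos]
  · change (Θ (t + T) - θ₁ (t + T)) / 2 = (Θ t - θ₁ t) / 2 + angle m / 2
    rw [hΘT, hθ₁T]; ring
  · change (Θ (t + T) - θ₁ (t + T)) / 2 = (Θ t - θ₁ t) / 2 + angle m / 2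
    rw [hΘT, hθ₁T]; ring

/-- If `β₂ = β₃ = angle m / 2` is a rational multiple of `π`, then the solution is one of the
solutions which the theorem is about, and `β₁ = -2 β₂` makes `a₁` even. -/
lemma exists_evenPeriodicSolution (h0 : 0 < m) (h1 : m < 1) (r : ℚ)
    (hr : angle m = 2 * Real.pi * r) : ∃ F : EvenPeriodicSolution, F.β 1 = Real.pi * r := by
  obtain ⟨D, T, hT, h₁, h₂, h₃⟩ := exists_solution h0 h1
  have hrr : (r : ℝ) = r.num / r.den := Rat.cast_def r
  have hden : (r.den : ℝ) ≠ 0 := by exact_mod_cast r.den_ne_zero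
  refine ⟨⟨D, T, ![-(2 * r.num), r.num, r.num], r.den, hT, ?_, r.den_pos, ?_, ?_⟩, ?_⟩
  · intro j t
    fin_cases j
    · refine (h₁ t).trans ?_
      simp [hr, hrr]; ring
    · refine (h₂ t).trans ?_
      simp [hr, hrr]; ring
    · refine (h₃ t).trans ?_
      simp [hr, hrr]; ring
  · refine Nat.Coprime.coprime_dvd_right ?_ r.reduced.symm
    exact Finset.gcd_dvd (Finset.mem_univ 1)
  · simp
  · simp [EvenPeriodicSolution.β, hrr]; ring

end

/-! ### Infinitely many rotation angles -/

lemma continuousOn_angle : ContinuousOn angle (Set.Ico 0 1) := by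
  rw [continuousOn_iff_continuous_domRestrict]
  have hgap : Continuous fun p : Set.Ico (0 : ℝ) 1 × ℝ => rootGap p.1 := by
    unfold rootGap; fun_prop
  have hprofile : Continuous fun p : Set.Ico (0 : ℝ) 1 × ℝ => profile p.1 p.2 := by
    unfold profile root₂; fun_prop
  have hspeed : Continuous fun p : Set.Ico (0 : ℝ) 1 × ℝ => speed p.1 p.2 := by
    unfold speed root₃; fun_prop
  refine intervalIntegral.continuous_parametric_intervalIntegral_of_continuous'
    (μ := MeasureTheory.volume) (f := fun (m : Set.Ico (0 : ℝ) 1) x => density m x) ?_ 0 Real.pi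
  change Continuous fun p : Set.Ico (0 : ℝ) 1 × ℝ =>
    consA p.1 / ((1 + profile p.1 p.2) * speed p.1 p.2)
  refine Continuous.div (by unfold consA; fun_prop) (by fun_prop) fun p => ?_
  exact (mul_pos (one_add_profile_pos p.1.2.1 p.1.2.2 _) (speed_pos p.1.2.1 p.1.2.2 _)).ne'

lemma angle_zero : angle 0 = 2 * Real.pi / √3 := by
  have h1 : rootGap 0 = 3 := by
    rw [rootGap, show (3 : ℝ) * (3 + 0) * (1 - 0) = 3 ^ 2 by norm_num]
    exact Real.sqrt_sq (by norm_num)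
  have h2 : ∀ x, density 0 x = 2 / √3 := fun x => by
    norm_num [density, consA, speed, profile, root₂, root₃, h1]
  simp only [angle, h2, intervalIntegral.integral_const, smul_eq_mul]
  ring

lemma hasDerivAt_arctan_primitive (x : ℝ) : HasDerivAt
    (fun x => (x + Real.arctan (3 * (Real.sin x * Real.cos x) / (1 + 3 * Real.sin x ^ 2))) / 4)
    (1 / (1 + 15 * Real.sin x ^ 2)) x := by
  have hs := Real.hasDerivAt_sin x
  have hc := Real.hasDerivAt_cos x
  have h3 : 0 < 1 + 3 * Real.sin x ^ 2 := by positivity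
  have h15 : 0 < 1 + 15 * Real.sin x ^ 2 := by positivity
  have h := (((hasDerivAt_id' x).add
    (((hs.fun_mul hc).const_mul 3).fun_div (((hs.fun_pow 2).const_mul 3).const_add 1)
      h3.ne').arctan).div_const 4)
  refine h.congr_deriv ?_
  have hcs := Real.cos_sq' x
  have h1 : 1 + (3 * (Real.sin x * Real.cos x) / (1 + 3 * Real.sin x ^ 2)) ^ 2 =
      (1 + 15 * Real.sin x ^ 2) / (1 + 3 * Real.sin x ^ 2) ^ 2 := by
    field_simp
    linear_combination 9 * Real.sin x ^ 2 * hcs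
  rw [h1]
  field_simp
  norm_num only [pow_one]
  linear_combination (3 - 9 * Real.sin x ^ 2) * hcs

lemma integral_inv_one_add_sin_sq :
    ∫ x in (0 : ℝ)..Real.pi, 1 / (1 + 15 * Real.sin x ^ 2) = Real.pi / 4 := by
  have hc : Continuous fun x => 1 / (1 + 15 * Real.sin x ^ 2) :=
    Continuous.div (by fun_prop) (by fun_prop) fun x => by positivity
  rw [intervalIntegral.integral_eq_sub_of_hasDerivAt (fun x _ => hasDerivAt_arctan_primitive x)
    (hc.intervalIntegrable _ _)]
  simp

/-- At `m = 6/7` the cubic `Q - A²` has rational roots. The concave function `s ↦ √(24 - 15 s)` is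
bounded below by a fractional linear function with which the integral is elementary. -/
lemma density_le (x : ℝ) :
    density (6 / 7) x ≤ 17 / 99 + 388 / 99 * (1 / (1 + 15 * Real.sin x ^ 2)) := by
  have h1 : rootGap (6 / 7) = 9 / 7 := by
    rw [rootGap, show (3 : ℝ) * (3 + 6 / 7) * (1 - 6 / 7) = (9 / 7) ^ 2 by norm_num]
    exact Real.sqrt_sq (by norm_num)
  have hs0 := sq_nonneg (Real.sin x)
  have hs1 := Real.sin_sq_le_one x
  set s := Real.sin x ^ 2 with hs
  have h2 : profile (6 / 7) x = -(6 / 7) + 15 / 7 * s := by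
    rw [profile, root₂, h1, ← hs]; ring
  have h3 : speed (6 / 7) x = √(24 - 15 * s) * √(1 / 7) := by
    rw [speed, h2, root₃, h1, ← Real.sqrt_mul (by linarith)]
    congr 1; ring
  have h4 : consA (6 / 7) = 20 / 7 * √(1 / 7) := by
    rw [consA, show (1 : ℝ) - 6 / 7 = 1 / 7 by norm_num]; ring
  have h7 : 0 < √(1 / 7 : ℝ) := Real.sqrt_pos.2 (by norm_num)
  have hr : 0 < √(24 - 15 * s) := Real.sqrt_pos.2 (by linarith)
  have h5 : 132 ≤ (27 + 17 * s) * √(24 - 15 * s) := by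
    refine le_of_sq_le_sq ?_ (by positivity)
    rw [mul_pow, Real.sq_sqrt (by linarith)]
    have : 0 ≤ (1 - s) * (72 + 11169 * s + 4335 * s ^ 2) :=
      mul_nonneg (by linarith) (by positivity)
    linarith
  have h6 : density (6 / 7) x = 20 / ((1 + 15 * s) * √(24 - 15 * s)) := by
    rw [density, h2, h3, h4]
    have : 1 + 15 * s ≠ 0 := by positivity
    rw [show (1 : ℝ) + (-(6 / 7) + 15 / 7 * s) = (1 + 15 * s) / 7 by ring]
    field_simp
  rw [h6, show 17 / 99 + 388 / 99 * (1 / (1 + 15 * s)) = 5 * (27 + 17 * s) / (33 * (1 + 15 * s)) by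
    field_simp; ring, div_le_div_iff₀ (by positivity) (by positivity)]
  have : 0 < 1 + 15 * s := by positivity
  nlinarith

lemma angle_le : angle (6 / 7) ≤ 38 / 33 * Real.pi := by
  have hc : Continuous fun x => 1 / (1 + 15 * Real.sin x ^ 2) :=
    Continuous.div (by fun_prop) (by fun_prop) fun x => by positivity
  calc angle (6 / 7) ≤ ∫ x in (0 : ℝ)..Real.pi,
          (17 / 99 + 388 / 99 * (1 / (1 + 15 * Real.sin x ^ 2))) :=
        intervalIntegral.integral_mono_on Real.pi_pos.le
          ((continuous_density (by norm_num) (by norm_num)).intervalIntegrable _ _)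
          ((continuous_const.add (continuous_const.mul hc)).intervalIntegrable _ _)
          fun x _ => density_le x
    _ = 38 / 33 * Real.pi := by
        rw [intervalIntegral.integral_add (by simp)
          ((hc.const_mul _).intervalIntegrable _ _), intervalIntegral.integral_const_mul,
          integral_inv_one_add_sin_sq, intervalIntegral.integral_const, smul_eq_mul]
        ring

/-- Every rational `r` in an interval gives a periodic solution with `β₂ = π r`: the angle depends
continuously on `m`, and it takes different values at `m = 0` and at `m = 6/7`. -/
lemma exists_β_eq {r : ℚ} (h : r ∈ Set.Ioo (19 / 33 : ℚ) (577 / 1000)) :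
    ∃ F : EvenPeriodicSolution, F.β 1 = Real.pi * r := by
  have hr0 : (19 / 33 : ℝ) < r := by simpa using (Rat.cast_lt (K := ℝ)).2 h.1
  have hr1 : (r : ℝ) < 577 / 1000 := by simpa using (Rat.cast_lt (K := ℝ)).2 h.2
  have hpi := Real.pi_pos
  have h3 : 2 * Real.pi * r < angle 0 := by
    have h4 : √3 < 1.733 := (Real.sqrt_lt' (by norm_num)).2 (by norm_num)
    have h5 : r * √3 < 1 := by nlinarith [Real.sqrt_nonneg 3]
    rw [angle_zero, lt_div_iff₀ (by positivity)]
    nlinarith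
  have hmem : 2 * Real.pi * r ∈ Set.Icc (angle (6 / 7)) (angle 0) :=
    ⟨angle_le.trans (by nlinarith), h3.le⟩
  obtain ⟨m, hm, hmr⟩ := intermediate_value_Icc' (by norm_num : (0 : ℝ) ≤ 6 / 7)
    (continuousOn_angle.mono fun m hm => ⟨hm.1, hm.2.trans_lt (by norm_num)⟩) hmem
  refine exists_evenPeriodicSolution (hm.1.lt_of_ne ?_) (hm.2.trans_lt (by norm_num)) r hmr
  rintro rfl
  exact h3.ne' hmr

lemma countable_range_β : (Set.range EvenPeriodicSolution.β).Countable := by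
  refine (Set.countable_range fun (p : (Fin 3 → ℤ) × ℕ) (j : Fin 3) =>
    Real.pi * p.1 j / p.2).mono ?_
  rintro _ ⟨F, rfl⟩
  exact ⟨(F.a, F.b), rfl⟩

lemma infinite_range_β : (Set.range EvenPeriodicSolution.β).Infinite := by
  have := (Set.Ioo_infinite (show (19 / 33 : ℚ) < 577 / 1000 by norm_num)).to_subtype
  choose F hF using fun r : Set.Ioo (19 / 33 : ℚ) (577 / 1000) => exists_β_eq r.2
  refine Set.infinite_of_injective_forall_mem (f := fun r => (F r).β) (fun r s hrs => ?_)
    fun r => ⟨F r, rfl⟩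
  have h := congrFun hrs 1
  simp only [hF] at h
  exact Subtype.ext (Rat.cast_injective (mul_left_cancel₀ Real.pi_ne_zero h))

end SLQuadric

end

open SLQuadric in
theorem theorem6p3 :
    -- the labels of the families form a countably infinite set
    ((Set.range EvenPeriodicSolution.β).Countable ∧ (Set.range EvenPeriodicSolution.β).Infinite) ∧
    -- members of families with different labels are distinct, and so are the members of one family
    (∀ (F G : EvenPeriodicSolution) (c c' : ℝ), F.N c = G.N c' → F.β = G.β) ∧
    (∀ F : EvenPeriodicSolution, Function.Injective F.N) ∧
    ∀ F : EvenPeriodicSolution,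
      -- (a)
      (∀ c : ℝ, 0 < c →
        F.N c = F.Npos c ∪ F.Nneg c ∧ F.Npos c ≠ F.Nneg c ∧ F.Nneg c = -F.Npos c ∧
        IsClosedImmersedSL ((𝓡 1).prod (𝓡 2)) (Circle × EuclideanSpace ℝ (Fin 2)) (F.Npos c) ∧
        IsClosedImmersedSL ((𝓡 1).prod (𝓡 2)) (Circle × EuclideanSpace ℝ (Fin 2)) (F.Nneg c)) ∧
      -- (b)
      (∀ c : ℝ, c < 0 →
        IsClosedImmersedSL (((𝓡 1).prod (𝓡 1)).prod 𝓘(ℝ, ℝ)) ((Circle × Circle) × ℝ) (F.N c) ∧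
        F.N c = -F.N c) ∧
      -- (c)
      (F.N 0 = F.Npos 0 ∪ F.Nneg 0 ∧ F.Npos 0 ≠ F.Nneg 0 ∧ F.Nneg 0 = -F.Npos 0 ∧
        IsClosedImmersedSLConeOnTorus (F.Npos 0) ∧
        IsClosedImmersedSLConeOnTorus (F.Nneg 0)) := by
  refine ⟨⟨countable_range_β, infinite_range_β⟩, fun F G c c' h =>
    EvenPeriodicSolution.β_eq_of_N_eq h, fun F => F.N_injective, fun F =>
    ⟨fun c hc => ?_, fun c hc => ⟨F.isClosedImmersedSL_N hc, F.N_eq_neg c⟩, ?_⟩⟩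
  · exact ⟨F.N_eq_union c, F.Npos_ne_Nneg hc.le, F.Nneg_eq_neg c, F.isClosedImmersedSL_Npos hc,
      F.Nneg_eq_neg c ▸ (F.isClosedImmersedSL_Npos hc).neg⟩
  · exact ⟨F.N_eq_union 0, F.Npos_ne_Nneg le_rfl, F.Nneg_eq_neg 0,
      F.isClosedImmersedSLConeOnTorus_Npos,
      F.Nneg_eq_neg 0 ▸ F.isClosedImmersedSLConeOnTorus_Npos.neg⟩
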